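/- Let $c>0$, $\lambda\in(0,\infty)$, $m\in\mathbb Z_+$, and let $Z=\{Z(t):t\ge 0\}$, $Z(0)=0$, be a compound Poisson process with jump rate $\lambda$ and drift $-c$ on a probability space $(\Omega,\mathcal F,\mathbb P)$: its jump epochs $T_1<T_2<\cdots$ form a Poisson process of rate $\lambda$, and $Z(t)=-ct+\sum_{i\ge1:\,T_i\le t}J_i$, where $J_i=Z(T_i)-Z(T_i-)>0$. The $i$-th jump carries a mark $M_i\in\mathbb R_+^m$; the pairs $(J_i,M_i)$, $i\ge1$, are independent and identically distributed and independent of $(T_i)_{i\ge1}$, while $J_i$ and $M_i$ may be dependent. Let $F$ be the distribution of $J_1$, and suppose $\mathbb E Z(1)<0$. Let $(\xi,M)$ have the same distribution as $(J_1,M_1)$ and be independent of $Z$ and of the marks $(M_i)_{i\ge1}$. Write $\mathbb E_\xi$ for expectations in which $Z$ is replaced by $\xi+Z$ and the initial mark is $M_0=M$. Put $T_0=0$, $$\tau_-=\inf\{t\ge0: Z(t)=0\},\qquad N_-=\inf\{n\ge0: Z(T_{n+1}-)\le0\}.$$ The function $\psi_{-Z}(\theta):=\log\mathbb E e^{-\theta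 Z(1)}$ satisfies $\psi_{-Z}(\theta)=c\theta-\lambda\int_{(0,\infty)}(1-e^{-\theta z})\,F(dz)$ for $\theta\ge0$, and it is a strictly increasing bijection of $[0,\infty)$ onto itself; let $\Phi_{-Z}:[0,\infty)\to[0,\infty)$ be its inverse. When the process is started from $\xi$, both $\tau_-$ and $N_-$ are almost surely finite, and for all $\beta,\gamma\ge0$ and $\kappa\in\mathbb R_+^m$, $$\mathbb E_\xi\, e^{-\beta(\tau_--T_{N_-})-\gamma\tau_--\langle\kappa,M_{N_-}\rangle} =\frac{[\beta+\gamma-c\,\Phi_{-Z}(\gamma)+\lambda]\;\mathbb E\, e^{-(\beta+\gamma+\lambda)\xi/c-\langle\kappa,M\rangle}}{\beta+\lambda\,\mathbb E\, e^{-(\beta+\gamma+\lambda)\xi/c}} =\frac{[\beta+\lambda\,\mathbb E_\xi e^{-\gamma\tau_-}]\;\mathbb E\, e^{-(\beta+\gamma+\lambda)\xi/c-\langle\kappa,M\rangle}}{\beta+\lambda\,\mathbb E\, e^{-(\beta+\gamma+\lambda)\xi/c}}.$$ -/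

import Mathlib

open MeasureTheory ProbabilityTheory Set
open scoped NNReal

noncomputable section

namespace MarkedCPP

/-- The jump epochs of a path `z` on `[0, ∞)`: `T 0 = 0`, and `T (n + 1)` is the first time after
`T n` at which `z` differs from its left limit. -/
def jumpEpoch (z : ℝ≥0 → ℝ) : ℕ → ℝ≥0
  | 0 => 0
  | n + 1 => sInf {t : ℝ≥0 | jumpEpoch z n < t ∧ z t ≠ Function.leftLim z t}

/-- The size `z (T n) - z (T n -)` of the `n`-th jump of the path `z` (for `n ≥ 1`). -/
def jumpSize (z : ℝ≥0 → ℝ) (n : ℕ) : ℝ :=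
  z (jumpEpoch z n) - Function.leftLim z (jumpEpoch z n)

/-- `τ₋ = inf {t ≥ 0 : z t = 0}`, the first hitting time of zero. -/
def hitZero (z : ℝ≥0 → ℝ) : ℝ≥0 := sInf {t : ℝ≥0 | z t = 0}

/-- `N₋ = inf {n ≥ 0 : z (T (n + 1) -) ≤ 0}`, the index of the last jump before hitting zero. -/
def lastJump (z : ℝ≥0 → ℝ) : ℕ := sInf {n : ℕ | Function.leftLim z (jumpEpoch z (n + 1)) ≤ 0}

variable {Ω : Type*} [MeasurableSpace Ω]

/-- The `n`-th interarrival time `T (n + 1) - T n` of the jumps of `Z`. -/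
def gap (Z : ℝ≥0 → Ω → ℝ) (n : ℕ) (ω : Ω) : ℝ :=
  (jumpEpoch (fun t => Z t ω) (n + 1) : ℝ) - jumpEpoch (fun t => Z t ω) n

/-- The pair consisting of the size and the mark of the `(n + 1)`-st jump of `Z`, the mark of the
`n`-th jump being `M n` for `n ≥ 1`. -/
def markedJump {m : ℕ} (Z : ℝ≥0 → Ω → ℝ) (M : ℕ → Ω → Fin m → ℝ) (n : ℕ) (ω : Ω) :
    ℝ × (Fin m → ℝ) :=
  (jumpSize (fun t => Z t ω) (n + 1), M (n + 1) ω)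

/-- Under `P`, `Z` is a compound Poisson process with jump rate `lam` and drift `-c`, started from
`0`, whose jumps carry the marks `M 1, M 2, …`; the joint law of a jump and its mark is `ν`.
The interarrival times of the jumps are i.i.d. exponential of rate `lam` (so the epochs form a
Poisson process), the pairs (jump, mark) are i.i.d. of law `ν` and independent of the epochs, and
`Z t = -c t +` (sum of the jumps up to time `t`). The value `M 0` plays no role here. -/
structure IsMarkedCompoundPoisson {m : ℕ} (P : Measure Ω) (c lam : ℝ)
    (ν : Measure (ℝ × (Fin m → ℝ))) (Z : ℝ≥0 → Ω → ℝ) (M : ℕ → Ω → Fin m → ℝ) : Prop where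
  gap_law : ∀ n, HasLaw (gap Z n) (expMeasure lam) P
  gap_indep : iIndepFun (gap Z) P
  jump_law : ∀ n, HasLaw (markedJump Z M n) ν P
  jump_indep : iIndepFun (markedJump Z M) P
  indep : IndepFun (fun ω n => gap Z n ω) (fun ω n => markedJump Z M n ω) P
  path : ∀ᵐ ω ∂P, ∀ (n : ℕ) (t : ℝ≥0),
    jumpEpoch (fun s => Z s ω) n ≤ t → t < jumpEpoch (fun s => Z s ω) (n + 1) →
      Z t ω = -c * t + ∑ i ∈ Finset.range n, jumpSize (fun s => Z s ω) (i + 1)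

/-- The Laplace exponent `ψ_{-Z}(θ) = log E exp(-θ Z(1))`. -/
def laplaceExponent (P : Measure Ω) (Z : ℝ≥0 → Ω → ℝ) (θ : ℝ) : ℝ :=
  Real.log (∫ ω, Real.exp (-θ * Z 1 ω) ∂P)

/-- The inverse `Φ_{-Z}` of `ψ_{-Z} : [0, ∞) → [0, ∞)`. -/
def invLaplaceExponent (P : Measure Ω) (Z : ℝ≥0 → Ω → ℝ) : ℝ → ℝ :=
  Function.invFunOn (laplaceExponent P Z) (Ici 0)

/-- The path `ξ + Z`, whose law under `P` is the law of the process under `P_ξ`. -/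
def startedPath (Z : ℝ≥0 → Ω → ℝ) (ξ : Ω → ℝ) (ω : Ω) (t : ℝ≥0) : ℝ := ξ ω + Z t ω

/-- The hitting time `τ₋` of zero, under `P_ξ`. -/
def tauMinus (Z : ℝ≥0 → Ω → ℝ) (ξ : Ω → ℝ) (ω : Ω) : ℝ := hitZero (startedPath Z ξ ω)

/-- The index `N₋` of the last jump before `τ₋`, under `P_ξ`. -/
def NMinus (Z : ℝ≥0 → Ω → ℝ) (ξ : Ω → ℝ) (ω : Ω) : ℕ := lastJump (startedPath Z ξ ω)

/-- The epoch `T_{N₋}` of the last jump before `τ₋`, under `P_ξ`; it is `0` if `N₋ = 0`. -/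
def lastEpoch (Z : ℝ≥0 → Ω → ℝ) (ξ : Ω → ℝ) (ω : Ω) : ℝ :=
  jumpEpoch (startedPath Z ξ ω) (NMinus Z ξ ω)

end MarkedCPP

end

/-! The start ξ with its mark has the law of a jump, so it can be counted as jump number 0. Sampled
just before its jumps, the process is then a random walk S_n (`walk`) with i.i.d. steps, jump minus
c times gap, and N_- = n exactly when S_1, ..., S_n > 0 ≥ S_{n+1}. In that case τ_- - T_n = (S_n +
Y_n)/c, with Y_n the n-th jump, so everything reduces to the killed transforms K_n(θ) = E[exp(-γ T_n
- θ S_n); S_1, ..., S_n > 0] (`killedTransform`).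

Let φ be the Laplace transform of a jump. Integrating out the last jump and gap gives two
identities. By the exponential tail, exit at step n+1 contributes K_n(θ₁) E exp(-θ₁ ξ - ⟨κ, M⟩) with
θ₁ = (β+γ+λ)/c (`integral_exitTerm`). Survival gives (λ+γ-cθ) K_{n+1}(θ) = λ (φ(θ) K_n(θ) - φ(θ₀)
K_n(θ₀)) with θ₀ = (λ+γ)/c (`killedTransform_succ`), and the subtracted product is the contribution
of step n+1 to E exp(-γ τ_-). At θ = θ₁ the coefficient is -β, and summing over n yields a linear
equation for Σ K_n(θ₁), hence the second formula (`integral_exitFunctional`). At θ = Φ(γ) the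
coefficient is λ φ(θ), the recursion telescopes, and E exp(-γ τ_-) = φ(Φ(γ)) once K_n → 0
(`integral_exitFunctional_root`); this turns the second formula into the first.

That K_n → 0 follows from almost sure exit (`measure_iInter_alive`), which comes from the same
telescoping at γ = ψ(θ) with θ ↓ 0. Positivity of ψ is Jensen's inequality: ψ(θ) ≥ -E Z(1) θ.
Together with convexity and continuity it also makes ψ a strictly increasing bijection. -/

namespace MarkedCPP

/-! ### Integrals against the exponential law -/

section Exponential

variable {lam : ℝ}

lemma integral_expMeasure (hlam : 0 < lam) (f : ℝ → ℝ) :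
    ∫ g, f g ∂(expMeasure lam) = ∫ g in Ioi 0, lam * Real.exp (-lam * g) * f g := by
  have hm : Measurable (gammaPDF 1 lam) := (measurable_gammaPDFReal 1 lam).ennreal_ofReal
  have h0 : ∀ g, (gammaPDF 1 lam g).toReal = if 0 ≤ g then lam * Real.exp (-lam * g) else 0 := by
    intro g
    have := exponentialPDF_eq lam g
    rw [exponentialPDF, exponentialPDFReal] at this
    rw [gammaPDF, this, ENNReal.toReal_ofReal]
    · simp
    · split_ifs <;> positivity
  rw [expMeasure, gammaMeasure, integral_withDensity_eq_integral_toReal_smul hm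
    (ae_of_all _ fun x => by simp [gammaPDF]), ← integral_indicator measurableSet_Ioi]
  refine integral_congr_ae ?_
  -- The density is nonzero at 0 but the integral runs over the open half-line; the two integrands
  -- differ only at this null point.
  filter_upwards [compl_mem_ae_iff.2 (measure_singleton (0 : ℝ))] with g hg
  rw [h0, indicator_apply, smul_eq_mul]
  have hg' : g ≠ 0 := hg
  by_cases h : 0 < g
  · simp [h, h.le]
  · rw [if_neg (fun h' => h (lt_of_le_of_ne h' hg'.symm)), if_neg (by simpa using h), zero_mul]

lemma integral_expMeasure_indicator_Iic (hlam : 0 < lam) {x : ℝ} (hx : 0 ≤ x) (f : ℝ → ℝ) :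
    ∫ g, (Iic x).indicator f g ∂(expMeasure lam) =
      ∫ g in 0..x, lam * Real.exp (-lam * g) * f g := by
  rw [integral_expMeasure hlam, intervalIntegral.integral_of_le hx, ← Ioi_inter_Iic,
    ← setIntegral_indicator measurableSet_Iic]
  congr 1 with g
  by_cases h : g ∈ Iic x <;> simp [h]

lemma integral_expMeasure_indicator_Iio (hlam : 0 < lam) {x : ℝ} (hx : 0 ≤ x) (f : ℝ → ℝ) :
    ∫ g, (Iio x).indicator f g ∂(expMeasure lam) =
      ∫ g in 0..x, lam * Real.exp (-lam * g) * f g := by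
  rw [integral_expMeasure hlam, intervalIntegral.integral_of_le hx, integral_Ioc_eq_integral_Ioo,
    ← Ioi_inter_Iio, ← setIntegral_indicator measurableSet_Iio]
  congr 1 with g
  by_cases h : g ∈ Iio x <;> simp [h]

/-- The multiplied form covers a = 0 as well. The recursion is applied where a = λ+γ-cθ may vanish,
so no division is made. -/
lemma mul_integral_exp_neg_mul (a x : ℝ) :
    a * ∫ g in 0..x, Real.exp (-a * g) = 1 - Real.exp (-a * x) := by
  rw [← intervalIntegral.integral_const_mul,
    intervalIntegral.integral_eq_sub_of_hasDerivAt (f := fun g => -Real.exp (-a * g))]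
  · simp; ring
  · intro g _
    have := (((hasDerivAt_id g).const_mul (-a)).exp).neg
    convert! this using 1
    simp; ring
  · exact (Continuous.intervalIntegrable (by fun_prop) _ _)

/-- The overshoot-free part of an exponentially discounted, exponentially timed downward drift. -/
lemma integral_expMeasure_drift {c γ θ y : ℝ} (hlam : 0 < lam) (hc : 0 < c) (hy : 0 ≤ y) :
    (lam + γ - c * θ) * ∫ g, (if 0 < y - c * g then
        Real.exp (-γ * g - θ * (y - c * g)) else 0) ∂(expMeasure lam) =
      lam * (Real.exp (-θ * y) - Real.exp (-((lam + γ) / c) * y)) := by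
  have h1 : (fun g => if 0 < y - c * g then Real.exp (-γ * g - θ * (y - c * g)) else 0) =
      (Iio (y / c)).indicator fun g => Real.exp (-γ * g - θ * (y - c * g)) := by
    ext g
    simp only [indicator_apply, mem_Iio, lt_div_iff₀ hc, sub_pos, mul_comm]
  rw [h1, integral_expMeasure_indicator_Iio hlam (by positivity)]
  have h2 : ∀ g, lam * Real.exp (-lam * g) * Real.exp (-γ * g - θ * (y - c * g)) =
      lam * Real.exp (-θ * y) * Real.exp (-(lam + γ - c * θ) * g) := by
    intro g
    rw [mul_assoc, mul_assoc, ← Real.exp_add, ← Real.exp_add]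
    ring_nf
  simp_rw [h2]
  rw [intervalIntegral.integral_const_mul, mul_left_comm, mul_integral_exp_neg_mul, mul_assoc,
    mul_sub, mul_one, ← Real.exp_add]
  congr 4
  field_simp
  ring

lemma integral_expMeasure_tail {x : ℝ} (hlam : 0 < lam) (hx : 0 ≤ x) :
    ∫ g, (Ici x).indicator (fun _ => (1 : ℝ)) g ∂(expMeasure lam) = Real.exp (-lam * x) := by
  have := isProbabilityMeasure_expMeasure hlam
  have h1 : (Ici x).indicator (fun _ => (1 : ℝ)) = fun g => 1 - (Iio x).indicator (fun _ => 1) g := by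
    ext g
    by_cases h : x ≤ g
    · simp [h]
    · simp [h, not_le.1 h]
  rw [h1, integral_sub (integrable_const _)
    ((integrable_const _).indicator measurableSet_Iio),
    integral_expMeasure_indicator_Iio hlam hx]
  simp only [mul_one]
  rw [intervalIntegral.integral_const_mul, mul_integral_exp_neg_mul]
  simp

lemma integral_expMeasure_tail_lt {x : ℝ} (hlam : 0 < lam) (hx : 0 ≤ x) :
    ∫ g, (Ioi x).indicator (fun _ => (1 : ℝ)) g ∂(expMeasure lam) = Real.exp (-lam * x) := by
  have := isProbabilityMeasure_expMeasure hlam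
  have h1 : (Ioi x).indicator (fun _ => (1 : ℝ)) = fun g => 1 - (Iic x).indicator (fun _ => 1) g := by
    ext g
    by_cases h : x < g
    · simp [h]
    · simp [h, not_lt.1 h]
  rw [h1, integral_sub (integrable_const _)
    ((integrable_const _).indicator measurableSet_Iic),
    integral_expMeasure_indicator_Iic hlam hx]
  simp only [mul_one]
  rw [intervalIntegral.integral_const_mul, mul_integral_exp_neg_mul]
  simp

/-- The factor exp(λg) cancels the density and leaves a polynomial integral; this is the induction
step for `integral_tiltedMoment`. -/
lemma integral_expMeasure_pow {x : ℝ} (hlam : 0 < lam) (hx : 0 ≤ x) (k : ℕ) :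
    ∫ g, (Iic x).indicator (fun g => Real.exp (lam * g) * (x - g) ^ k) g ∂(expMeasure lam) =
      lam * x ^ (k + 1) / (k + 1) := by
  rw [integral_expMeasure_indicator_Iic hlam hx]
  have h2 : ∀ g, lam * Real.exp (-lam * g) * (Real.exp (lam * g) * (x - g) ^ k) =
      lam * (x - g) ^ k := by
    intro g
    rw [mul_assoc, ← mul_assoc (Real.exp _), ← Real.exp_add]
    simp
  simp_rw [h2]
  rw [intervalIntegral.integral_const_mul, intervalIntegral.integral_comp_sub_left (fun g => g ^ k)]
  simp [integral_pow]
  ring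

lemma integral_expMeasure_exp {γ : ℝ} (hlam : 0 < lam) (hγ : 0 ≤ γ) :
    ∫ g, Real.exp (-γ * g) ∂(expMeasure lam) = lam / (lam + γ) := by
  rw [integral_expMeasure hlam]
  have h2 : ∀ g, lam * Real.exp (-lam * g) * Real.exp (-γ * g) =
      lam * Real.exp (-(lam + γ) * g) := by
    intro g
    rw [mul_assoc, ← Real.exp_add]
    ring_nf
  simp_rw [h2]
  rw [integral_const_mul, integral_exp_mul_Ioi (by linarith)]
  have : lam + γ ≠ 0 := by positivity
  simp only [mul_zero, Real.exp_zero, neg_div_neg_eq]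
  field_simp

lemma ae_expMeasure_pos (hlam : 0 < lam) : ∀ᵐ g ∂(expMeasure lam), 0 < g := by
  have := isProbabilityMeasure_expMeasure hlam
  have h := integral_expMeasure_indicator_Iic hlam le_rfl (fun _ => 1)
  rw [intervalIntegral.integral_same, integral_indicator_const _ measurableSet_Iic] at h
  rw [ae_iff]
  have h0 : {a : ℝ | ¬ 0 < a} = Iic 0 := by ext; simp
  rw [h0]
  simpa [measureReal_eq_zero_iff] using h

lemma expMeasure_singleton (x : ℝ) : expMeasure lam {x} = 0 := by
  rw [expMeasure, gammaMeasure]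
  exact withDensity_absolutelyContinuous _ _ (measure_singleton x)

end Exponential

/-! ### Independent sources and integrating out one step -/

section Independence

variable {Ω : Type*} {mΩ : MeasurableSpace Ω} {P : Measure Ω}

/-- A finite intersection splits into a part from each summand; the two parts lie in the two
suprema, so independence of these separates them and each family then factors by itself. -/
lemma iIndep_sum [IsProbabilityMeasure P] {α β : Type*} {m : α ⊕ β → MeasurableSpace Ω}
    (h₁ : iIndep (fun a => m (.inl a)) P) (h₂ : iIndep (fun b => m (.inr b)) P)
    (h : Indep (⨆ a, m (.inl a)) (⨆ b, m (.inr b)) P) : iIndep m P := by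
  classical
  rw [iIndep_iff]
  intro s f hf
  have h3 : ⋂ i ∈ s, f i =
      (⋂ a ∈ s.toLeft, f (.inl a)) ∩ ⋂ b ∈ s.toRight, f (.inr b) := by
    ext ω
    simp only [mem_iInter, mem_inter_iff, Finset.mem_toLeft, Finset.mem_toRight]
    exact ⟨fun h => ⟨fun a => h _, fun b => h _⟩, fun h i => by
      cases i with
      | inl a => exact h.1 a
      | inr b => exact h.2 b⟩
  rw [h3, (Indep_iff _ _ _).1 h]
  · rw [(iIndep_iff _ _).1 h₁ s.toLeft (f := fun a => f (.inl a))
      (fun i hi => hf _ (Finset.mem_toLeft.1 hi)),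
      (iIndep_iff _ _).1 h₂ s.toRight (f := fun a => f (.inr a))
      (fun i hi => hf _ (Finset.mem_toRight.1 hi)), Finset.prod_sum_eq_prod_toLeft_mul_prod_toRight]
  · exact Finset.measurableSet_biInter _ fun a ha =>
      (le_iSup (fun a => m (.inl a)) a) _ (hf _ (Finset.mem_toLeft.1 ha))
  · exact Finset.measurableSet_biInter _ fun a ha =>
      (le_iSup (fun a => m (.inr a)) a) _ (hf _ (Finset.mem_toRight.1 ha))

variable {E : Type*} [MeasurableSpace E]

/-- The pairs `(Y n, g n)` are i.i.d. of law `ν ⊗ Exp(lam)` with respect to a filtration. -/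
structure IsDriven (P : Measure Ω) (lam : ℝ) (ν : Measure E) (𝓕 : Filtration ℕ mΩ)
    (Y : ℕ → Ω → E) (g : ℕ → Ω → ℝ) : Prop where
  meas_fst : ∀ n, Measurable[𝓕 (n + 1)] (Y n)
  meas_snd : ∀ n, Measurable[𝓕 (n + 1)] (g n)
  indep : ∀ n, Indep (𝓕 n) (MeasurableSpace.comap (fun ω => (Y n ω, g n ω)) inferInstance) P
  map_eq : ∀ n, P.map (fun ω => (Y n ω, g n ω)) = ν.prod (expMeasure lam)

/-- The filtration generated by the σ-algebras of level less than `n`. -/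
def levelFiltration {ι : Type*} (m : ι → MeasurableSpace Ω) (hm : ∀ i, m i ≤ mΩ) (level : ι → ℕ) :
    Filtration ℕ mΩ where
  seq n := ⨆ i ∈ {i | level i < n}, m i
  mono' _ _ h := biSup_mono fun _ hi => lt_of_lt_of_le hi h
  le' _ := iSup₂_le fun i _ => hm i

/-- Sources of level below n and sources of level n form disjoint families, so they generate
independent σ-algebras. The condition `a n ≠ b n` makes the joint law of the pair a product. -/
lemma isDriven_levelFiltration [IsProbabilityMeasure P] {ι : Type*} {m : ι → MeasurableSpace Ω}
    (hm : ∀ i, m i ≤ mΩ) (hind : iIndep m P) (level : ι → ℕ) {lam : ℝ} {ν : Measure E}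
    {Y : ℕ → Ω → E} {g : ℕ → Ω → ℝ} (a b : ℕ → ι) (ha : ∀ n, level (a n) = n)
    (hb : ∀ n, level (b n) = n) (hab : ∀ n, a n ≠ b n) (hY : ∀ n, Measurable[m (a n)] (Y n))
    (hg : ∀ n, Measurable[m (b n)] (g n)) (hYlaw : ∀ n, P.map (Y n) = ν)
    (hglaw : ∀ n, P.map (g n) = expMeasure lam) :
    IsDriven P lam ν (levelFiltration m hm level) Y g where
  meas_fst n := (hY n).mono (le_iSup₂_of_le (a n) (by simp [ha]) le_rfl) le_rfl
  meas_snd n := (hg n).mono (le_iSup₂_of_le (b n) (by simp [hb]) le_rfl) le_rfl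
  indep n := by
    have hd : Disjoint {i | level i < n} {i | level i = n} :=
      Set.disjoint_left.2 fun i (h : level i < n) (h' : level i = n) => by omega
    refine indep_of_indep_of_le_right (indep_iSup_of_disjoint hm hind hd) ?_
    rw [← measurable_iff_comap_le]
    refine Measurable.prodMk ?_ ?_
    · exact (hY n).mono (le_iSup₂_of_le (a n) (ha n) le_rfl) le_rfl
    · exact (hg n).mono (le_iSup₂_of_le (b n) (hb n) le_rfl) le_rfl
  map_eq n := by
    have h1 : IndepFun (Y n) (g n) P := by
      rw [IndepFun_iff_Indep]
      exact indep_of_indep_of_le_right (indep_of_indep_of_le_left (hind.indep (hab n))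
        (measurable_iff_comap_le.1 (hY n))) (measurable_iff_comap_le.1 (hg n))
    rw [(indepFun_iff_map_prod_eq_prod_map_map ((hY n).mono (hm _) le_rfl).aemeasurable
      ((hg n).mono (hm _) le_rfl).aemeasurable).1 h1, hYlaw, hglaw]

namespace IsDriven

variable {lam : ℝ} {ν : Measure E} {𝓕 : Filtration ℕ mΩ} {Y : ℕ → Ω → E} {g : ℕ → Ω → ℝ}

lemma measurable_fst (h : IsDriven P lam ν 𝓕 Y g) (n : ℕ) : Measurable (Y n) :=
  (h.meas_fst n).mono (𝓕.le _) le_rfl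

lemma measurable_snd (h : IsDriven P lam ν 𝓕 Y g) (n : ℕ) : Measurable (g n) :=
  (h.meas_snd n).mono (𝓕.le _) le_rfl

lemma map_fst (h : IsDriven P lam ν 𝓕 Y g) (hlam : 0 < lam) (n : ℕ) : P.map (Y n) = ν := by
  have := isProbabilityMeasure_expMeasure hlam
  have h1 := congrArg (Measure.map Prod.fst) (h.map_eq n)
  rw [Measure.map_map _root_.measurable_fst ((h.measurable_fst n).prodMk (h.measurable_snd n)),
    Measure.map_fst_prod] at h1
  simpa [Function.comp_def] using h1

lemma isProbabilityMeasure [IsProbabilityMeasure P] (h : IsDriven P lam ν 𝓕 Y g)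
    (hlam : 0 < lam) : IsProbabilityMeasure ν := by
  rw [← h.map_fst hlam 0]
  exact Measure.isProbabilityMeasure_map (h.measurable_fst 0).aemeasurable

lemma map_snd [IsProbabilityMeasure P] (h : IsDriven P lam ν 𝓕 Y g) (hlam : 0 < lam) (n : ℕ) :
    P.map (g n) = expMeasure lam := by
  have := isProbabilityMeasure_expMeasure hlam
  have := h.isProbabilityMeasure hlam
  have h1 := congrArg (Measure.map Prod.snd) (h.map_eq n)
  rw [Measure.map_map _root_.measurable_snd ((h.measurable_fst n).prodMk (h.measurable_snd n)),
    Measure.map_snd_prod] at h1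
  simpa [Function.comp_def] using h1

lemma ae_snd_pos [IsProbabilityMeasure P] (h : IsDriven P lam ν 𝓕 Y g) (hlam : 0 < lam) :
    ∀ᵐ ω ∂P, ∀ n, 0 < g n ω := by
  rw [ae_all_iff]
  intro n
  have := ae_expMeasure_pos hlam
  rw [← h.map_snd hlam n] at this
  exact ae_of_ae_map (h.measurable_snd n).aemeasurable this

lemma ae_fst (h : IsDriven P lam ν 𝓕 Y g) (hlam : 0 < lam) {p : E → Prop}
    (hp : ∀ᵐ y ∂ν, p y) : ∀ᵐ ω ∂P, ∀ n, p (Y n ω) := by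
  rw [ae_all_iff]
  intro n
  rw [← h.map_fst hlam n] at hp
  exact ae_of_ae_map (h.measurable_fst n).aemeasurable hp

/-- Integrating out the pair that is independent of the past. -/
lemma integral_step [IsProbabilityMeasure P] (h : IsDriven P lam ν 𝓕 Y g) (hlam : 0 < lam) (n : ℕ)
    {G : Type*} [MeasurableSpace G] {s : Ω → G} (hs : Measurable[𝓕 n] s)
    {f : G → E → ℝ → ℝ} (hf : Measurable fun q : G × (E × ℝ) => f q.1 q.2.1 q.2.2)
    (hint : Integrable (fun ω => f (s ω) (Y n ω) (g n ω)) P) :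
    ∫ ω, f (s ω) (Y n ω) (g n ω) ∂P =
      ∫ ω, ∫ y, ∫ t, f (s ω) y t ∂(expMeasure lam) ∂ν ∂P := by
  have := isProbabilityMeasure_expMeasure hlam
  have := h.isProbabilityMeasure hlam
  have hs' : Measurable s := hs.mono (𝓕.le _) le_rfl
  have hq := (h.measurable_fst n).prodMk (h.measurable_snd n)
  have hI : IndepFun s (fun ω => (Y n ω, g n ω)) P := by
    rw [IndepFun_iff_Indep]
    exact indep_of_indep_of_le_left (h.indep n) (measurable_iff_comap_le.1 hs)
  have hmap := (indepFun_iff_map_prod_eq_prod_map_map hs'.aemeasurable hq.aemeasurable).1 hI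
  rw [h.map_eq] at hmap
  have hint' : Integrable (fun q : G × (E × ℝ) => f q.1 q.2.1 q.2.2)
      ((P.map s).prod (ν.prod (expMeasure lam))) := by
    rw [← hmap]
    exact (integrable_map_measure hf.aestronglyMeasurable
      (hs'.prodMk hq).aemeasurable).2 hint
  have e1 := integral_map (hs'.prodMk hq).aemeasurable (μ := P) (hf.aestronglyMeasurable)
  have := Measure.isProbabilityMeasure_map (μ := P) hs'.aemeasurable
  rw [← e1, hmap, integral_prod _ hint']
  refine (integral_map hs'.aemeasurable hint'.integral_prod_left.aestronglyMeasurable).trans ?_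
  refine integral_congr_ae ?_
  filter_upwards [ae_of_ae_map hs'.aemeasurable hint'.prod_right_ae] with ω hω
  exact integral_prod _ hω

end IsDriven

end Independence

/-! ### The killed walk and its one-step recursion -/

section Walk

variable {Ω : Type*} {mΩ : MeasurableSpace Ω} {P : Measure Ω} {m : ℕ}

lemma integrable_of_unit [IsFiniteMeasure P] {f : Ω → ℝ} (hf : Measurable f)
    (h : ∀ᵐ ω ∂P, 0 ≤ f ω ∧ f ω ≤ 1) : Integrable f P :=
  Integrable.of_bound hf.aestronglyMeasurable 1 <| h.mono fun ω hω => by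
    rw [Real.norm_eq_abs, abs_of_nonneg hω.1]
    exact hω.2

/-- The time elapsed after `n` gaps. -/
noncomputable def clock (g : ℕ → Ω → ℝ) (n : ℕ) (ω : Ω) : ℝ := ∑ i ∈ Finset.range n, g i ω

/-- The level just before the next jump, after `n` jumps and `n` gaps of downward drift. -/
noncomputable def walk (c : ℝ) (Y : ℕ → Ω → ℝ × (Fin m → ℝ)) (g : ℕ → Ω → ℝ) (n : ℕ) (ω : Ω) : ℝ :=
  ∑ i ∈ Finset.range n, ((Y i ω).1 - c * g i ω)

/-- The event that the walk has stayed positive for `n` steps. -/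
def alive (c : ℝ) (Y : ℕ → Ω → ℝ × (Fin m → ℝ)) (g : ℕ → Ω → ℝ) (n : ℕ) : Set Ω :=
  {ω | ∀ k < n, 0 < walk c Y g (k + 1) ω}

/-- The discount factor `exp (-γ T n)` on the event that the walk is alive. -/
noncomputable def weight (c γ : ℝ) (Y : ℕ → Ω → ℝ × (Fin m → ℝ)) (g : ℕ → Ω → ℝ) (n : ℕ) : Ω → ℝ :=
  (alive c Y g n).indicator fun ω => Real.exp (-γ * clock g n ω)

/-- The Laplace transform of the discounted killed walk. -/
noncomputable def killedTransform (P : Measure Ω) (c γ : ℝ) (Y : ℕ → Ω → ℝ × (Fin m → ℝ))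
    (g : ℕ → Ω → ℝ) (θ : ℝ) (n : ℕ) : ℝ :=
  ∫ ω, weight c γ Y g n ω * Real.exp (-θ * walk c Y g n ω) ∂P

/-- The Laplace transform of the first marginal. -/
noncomputable def jumpTransform (ν : Measure (ℝ × (Fin m → ℝ))) (θ : ℝ) : ℝ :=
  ∫ p, Real.exp (-θ * p.1) ∂ν

variable {c γ lam : ℝ} {ν : Measure (ℝ × (Fin m → ℝ))}

lemma integrable_exp_jump [IsFiniteMeasure ν] (hν : ∀ᵐ p ∂ν, 0 < p.1) {θ : ℝ} (hθ : 0 ≤ θ) :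
    Integrable (fun p : ℝ × (Fin m → ℝ) => Real.exp (-θ * p.1)) ν := by
  refine integrable_of_unit (by fun_prop) ?_
  filter_upwards [hν] with p hp
  exact ⟨(Real.exp_pos _).le, Real.exp_le_one_iff.2 (by nlinarith)⟩

variable {𝓕 : Filtration ℕ mΩ}
  {Y : ℕ → Ω → ℝ × (Fin m → ℝ)} {g : ℕ → Ω → ℝ}

lemma clock_succ (n : ℕ) (ω : Ω) : clock g (n + 1) ω = clock g n ω + g n ω :=
  Finset.sum_range_succ _ _

lemma walk_succ (n : ℕ) (ω : Ω) :
    walk c Y g (n + 1) ω = walk c Y g n ω + (Y n ω).1 - c * g n ω := by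
  rw [walk, Finset.sum_range_succ, add_sub_assoc, walk]

lemma mem_alive_succ {n : ℕ} {ω : Ω} :
    ω ∈ alive c Y g (n + 1) ↔ ω ∈ alive c Y g n ∧ 0 < walk c Y g (n + 1) ω := by
  simp only [alive, mem_ofPred_eq, Nat.lt_succ_iff_lt_or_eq]
  exact ⟨fun h => ⟨fun k hk => h k (.inl hk), h n (.inr rfl)⟩,
    fun h k hk => hk.elim (h.1 k) fun h' => h' ▸ h.2⟩

/-- Only weak positivity is available, because S_0 = 0. -/
lemma walk_nonneg {n : ℕ} {ω : Ω} (h : ω ∈ alive c Y g n) : 0 ≤ walk c Y g n ω := by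
  cases n with
  | zero => simp [walk]
  | succ n => exact (h n n.lt_succ_self).le

lemma clock_nonneg {ω : Ω} (h : ∀ n, 0 < g n ω) (n : ℕ) : 0 ≤ clock g n ω :=
  Finset.sum_nonneg fun i _ => (h i).le

lemma weight_nonneg (n : ℕ) (ω : Ω) : 0 ≤ weight c γ Y g n ω :=
  indicator_nonneg (fun _ _ => (Real.exp_pos _).le) _

lemma weight_le_one (hγ : 0 ≤ γ) {ω : Ω} (h : ∀ n, 0 < g n ω) (n : ℕ) :
    weight c γ Y g n ω ≤ 1 := by
  refine indicator_apply_le' (fun _ => ?_) fun _ => zero_le_one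
  rw [Real.exp_le_one_iff]
  nlinarith [clock_nonneg h n]

lemma weight_succ (n : ℕ) (ω : Ω) : weight c γ Y g (n + 1) ω = weight c γ Y g n ω *
    if 0 < walk c Y g n ω + (Y n ω).1 - c * g n ω then Real.exp (-γ * g n ω) else 0 := by
  have h3 := mem_alive_succ (c := c) (Y := Y) (g := g) (n := n) (ω := ω)
  rw [walk_succ] at h3
  simp only [weight, clock_succ, mul_add, Real.exp_add]
  by_cases h1 : ω ∈ alive c Y g n <;>
    by_cases h2 : 0 < walk c Y g n ω + (Y n ω).1 - c * g n ω <;> simp [h1, h2, h3]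

namespace IsDriven

lemma measurable_clock (h : IsDriven P lam ν 𝓕 Y g) (n : ℕ) : Measurable[𝓕 n] (clock g n) := by
  unfold clock
  exact Finset.measurable_fun_sum _ fun i hi =>
    (h.meas_snd i).mono (𝓕.mono (Finset.mem_range.1 hi)) le_rfl

lemma measurable_walk (h : IsDriven P lam ν 𝓕 Y g) (n : ℕ) : Measurable[𝓕 n] (walk c Y g n) := by
  unfold walk
  refine Finset.measurable_fun_sum _ fun i hi => ?_
  have h1 := (h.meas_snd i).mono (𝓕.mono (Finset.mem_range.1 hi)) le_rfl
  have h2 := (h.meas_fst i).mono (𝓕.mono (Finset.mem_range.1 hi)) le_rfl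
  exact (_root_.measurable_fst.comp h2).sub (h1.const_mul c)

lemma measurableSet_alive (h : IsDriven P lam ν 𝓕 Y g) (n : ℕ) :
    MeasurableSet[𝓕 n] (alive c Y g n) := by
  have : alive c Y g n = ⋂ k, ⋂ (_ : k < n), walk c Y g (k + 1) ⁻¹' Ioi 0 := by
    ext ω; simp [alive]
  rw [this]
  refine MeasurableSet.iInter fun k => MeasurableSet.iInter fun hk => ?_
  exact (𝓕.mono (Nat.succ_le_of_lt hk)) _ ((h.measurable_walk (k + 1)) measurableSet_Ioi)

lemma measurable_weight (h : IsDriven P lam ν 𝓕 Y g) (n : ℕ) :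
    Measurable[𝓕 n] (weight c γ Y g n) := by
  have h1 : Measurable[𝓕 n] fun ω => Real.exp (-γ * clock g n ω) :=
    Real.measurable_exp.comp ((h.measurable_clock n).const_mul (-γ))
  exact Measurable.indicator h1 (h.measurableSet_alive n)

variable [IsProbabilityMeasure P]

lemma weight_mul_exp_mem (h : IsDriven P lam ν 𝓕 Y g) (hlam : 0 < lam) (hγ : 0 ≤ γ)
    {θ : ℝ} (hθ : 0 ≤ θ) : ∀ᵐ ω ∂P, ∀ n,
      0 ≤ weight c γ Y g n ω * Real.exp (-θ * walk c Y g n ω) ∧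
      weight c γ Y g n ω * Real.exp (-θ * walk c Y g n ω) ≤ 1 := by
  filter_upwards [h.ae_snd_pos hlam] with ω hω n
  refine ⟨mul_nonneg (weight_nonneg _ _) (Real.exp_pos _).le, ?_⟩
  by_cases h1 : ω ∈ alive c Y g n
  · refine mul_le_one₀ (weight_le_one hγ hω n) (Real.exp_pos _).le (Real.exp_le_one_iff.2 ?_)
    nlinarith [walk_nonneg h1]
  · simp [weight, h1]

lemma integrable_weight_mul_exp (h : IsDriven P lam ν 𝓕 Y g) (hlam : 0 < lam) (hγ : 0 ≤ γ)
    {θ : ℝ} (hθ : 0 ≤ θ) (n : ℕ) :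
    Integrable (fun ω => weight c γ Y g n ω * Real.exp (-θ * walk c Y g n ω)) P := by
  have h1 : Measurable (weight c γ Y g n) := (h.measurable_weight n).mono (𝓕.le _) le_rfl
  have h2 : Measurable (walk c Y g n) := (h.measurable_walk n).mono (𝓕.le _) le_rfl
  exact integrable_of_unit (by fun_prop) ((h.weight_mul_exp_mem hlam hγ hθ).mono fun ω hω => hω n)

/-- One step of the killed walk: the killed part is removed through the transform at
`(lam + γ) / c`. -/
lemma killedTransform_succ (h : IsDriven P lam ν 𝓕 Y g) (hlam : 0 < lam) (hc : 0 < c) (hγ : 0 ≤ γ)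
    (hν : ∀ᵐ p ∂ν, 0 < p.1) {θ : ℝ} (hθ : 0 ≤ θ) (n : ℕ) :
    (lam + γ - c * θ) * killedTransform P c γ Y g θ (n + 1) =
      lam * (jumpTransform ν θ * killedTransform P c γ Y g θ n -
        jumpTransform ν ((lam + γ) / c) * killedTransform P c γ Y g ((lam + γ) / c) n) := by
  have := h.isProbabilityMeasure hlam
  have hθ' : 0 ≤ (lam + γ) / c := by positivity
  let f : ℝ × ℝ → ℝ × (Fin m → ℝ) → ℝ → ℝ := fun s y t => s.1 *
    if 0 < s.2 + y.1 - c * t then Real.exp (-γ * t - θ * (s.2 + y.1 - c * t)) else 0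
  have hf : Measurable fun q : (ℝ × ℝ) × ((ℝ × (Fin m → ℝ)) × ℝ) => f q.1 q.2.1 q.2.2 :=
    (by fun_prop : Measurable fun q : (ℝ × ℝ) × ((ℝ × (Fin m → ℝ)) × ℝ) => q.1.1).mul
      (Measurable.ite (measurableSet_lt (by fun_prop) (by fun_prop)) (by fun_prop) (by fun_prop))
  have hs : Measurable[𝓕 n] fun ω => (weight c γ Y g n ω, walk c Y g n ω) :=
    (h.measurable_weight n).prodMk (h.measurable_walk n)
  have e1 : (fun ω => weight c γ Y g (n + 1) ω * Real.exp (-θ * walk c Y g (n + 1) ω)) =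
      fun ω => f (weight c γ Y g n ω, walk c Y g n ω) (Y n ω) (g n ω) := by
    ext ω
    simp only [f, weight_succ, walk_succ]
    split_ifs with h1
    · rw [mul_assoc, ← Real.exp_add]
      ring_nf
    · simp
  have hint := h.integrable_weight_mul_exp (c := c) hlam hγ hθ (n + 1)
  rw [e1] at hint
  rw [killedTransform, e1, h.integral_step hlam n hs hf hint, ← integral_const_mul]
  have e2 : ∀ ω, (lam + γ - c * θ) * ∫ y, ∫ t, f (weight c γ Y g n ω, walk c Y g n ω) y t
      ∂(expMeasure lam) ∂ν =
      lam * jumpTransform ν θ * (weight c γ Y g n ω * Real.exp (-θ * walk c Y g n ω)) -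
      lam * jumpTransform ν ((lam + γ) / c) *
        (weight c γ Y g n ω * Real.exp (-((lam + γ) / c) * walk c Y g n ω)) := by
    intro ω
    -- Alive, S_n + Y_n is nonnegative and the drift formula applies with y = S_n + Y_n; its two
    -- exponentials then split into a factor of the past and a factor of the jump. Otherwise all
    -- terms vanish.
    by_cases h1 : ω ∈ alive c Y g n
    · have hu := walk_nonneg h1
      simp only [f, integral_const_mul]
      rw [mul_left_comm, ← integral_const_mul]
      have e3 : ∀ᵐ y ∂ν, (lam + γ - c * θ) * ∫ t, (if 0 < walk c Y g n ω + y.1 - c * t then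
          Real.exp (-γ * t - θ * (walk c Y g n ω + y.1 - c * t)) else 0) ∂(expMeasure lam) =
          lam * Real.exp (-θ * walk c Y g n ω) * Real.exp (-θ * y.1) -
          lam * Real.exp (-((lam + γ) / c) * walk c Y g n ω) *
            Real.exp (-((lam + γ) / c) * y.1) := by
        filter_upwards [hν] with y hy
        rw [integral_expMeasure_drift hlam hc (by positivity), mul_add, mul_add, Real.exp_add,
          Real.exp_add]
        ring
      rw [integral_congr_ae e3, integral_sub ((integrable_exp_jump hν hθ).const_mul _)
        ((integrable_exp_jump hν hθ').const_mul _), integral_const_mul, integral_const_mul,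
        jumpTransform, jumpTransform]
      ring
    · simp [f, weight, h1]
  simp_rw [e2]
  rw [integral_sub ((h.integrable_weight_mul_exp hlam hγ hθ n).const_mul _)
    ((h.integrable_weight_mul_exp hlam hγ hθ' n).const_mul _), integral_const_mul,
    integral_const_mul, killedTransform, killedTransform]
  ring

end IsDriven

end Walk

/-! ### Exit contributions and almost sure exit -/

section Exit

variable {Ω : Type*} {mΩ : MeasurableSpace Ω} {P : Measure Ω} {m : ℕ}

/-- The event that the walk first becomes nonpositive at step `n + 1`. -/
def exitAt (c : ℝ) (Y : ℕ → Ω → ℝ × (Fin m → ℝ)) (g : ℕ → Ω → ℝ) (n : ℕ) : Set Ω :=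
  alive c Y g n \ alive c Y g (n + 1)

/-- The exit functional on the event that exit takes place at step `n + 1`. -/
noncomputable def exitTerm (c β γ : ℝ) (κ : Fin m → ℝ) (Y : ℕ → Ω → ℝ × (Fin m → ℝ))
    (g : ℕ → Ω → ℝ) (n : ℕ) : Ω → ℝ :=
  (exitAt c Y g n).indicator fun ω => Real.exp (-γ * clock g n ω
    - (β + γ) / c * (walk c Y g n ω + (Y n ω).1) - κ ⬝ᵥ (Y n ω).2)

/-- The Laplace transform of a jump and its mark. -/
noncomputable def markTransform (ν : Measure (ℝ × (Fin m → ℝ))) (θ : ℝ) (κ : Fin m → ℝ) : ℝ :=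
  ∫ p, Real.exp (-θ * p.1 - κ ⬝ᵥ p.2) ∂ν

variable {c β γ lam : ℝ} {ν : Measure (ℝ × (Fin m → ℝ))} {𝓕 : Filtration ℕ mΩ}
  {Y : ℕ → Ω → ℝ × (Fin m → ℝ)} {g : ℕ → Ω → ℝ} {κ : Fin m → ℝ}

lemma alive_succ_subset (n : ℕ) : alive c Y g (n + 1) ⊆ alive c Y g n :=
  fun _ h => (mem_alive_succ.1 h).1

lemma alive_zero : alive c Y g 0 = univ := by simp [alive]

lemma alive_antitone : Antitone (alive c Y g) := antitone_nat_of_succ_le alive_succ_subset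

lemma mem_exitAt {n : ℕ} {ω : Ω} : ω ∈ exitAt c Y g n ↔
    (∀ k < n, 0 < walk c Y g (k + 1) ω) ∧ walk c Y g (n + 1) ω ≤ 0 := by
  rw [exitAt, mem_sdiff, mem_alive_succ, ← not_lt]
  simp only [alive, mem_ofPred_eq]
  tauto

lemma markTransform_zero (θ : ℝ) : markTransform ν θ 0 = jumpTransform ν θ := by
  simp [markTransform, jumpTransform]

lemma dotProduct_nonneg' {κ x : Fin m → ℝ} (hκ : ∀ i, 0 ≤ κ i) (hx : ∀ i, 0 ≤ x i) :
    0 ≤ κ ⬝ᵥ x := Finset.sum_nonneg fun i _ => mul_nonneg (hκ i) (hx i)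

lemma exitTerm_nonneg (n : ℕ) (ω : Ω) : 0 ≤ exitTerm c β γ κ Y g n ω :=
  indicator_nonneg (fun _ _ => (Real.exp_pos _).le) _

lemma exitTerm_le (hc : 0 < c) (hβ : 0 ≤ β) (hγ : 0 ≤ γ) (hκ : ∀ i, 0 ≤ κ i) {ω : Ω}
    (hg : ∀ n, 0 < g n ω) (hY : ∀ n, 0 < (Y n ω).1 ∧ ∀ i, 0 ≤ (Y n ω).2 i) (n : ℕ) :
    exitTerm c β γ κ Y g n ω ≤ (exitAt c Y g n).indicator (fun _ => 1) ω := by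
  refine indicator_le_indicator' fun h => Real.exp_le_one_iff.2 ?_
  have h1 := clock_nonneg hg n
  have h2 := walk_nonneg h.1
  have h3 := dotProduct_nonneg' hκ (hY n).2
  have h4 : 0 ≤ (β + γ) / c * (walk c Y g n ω + (Y n ω).1) :=
    mul_nonneg (by positivity) (add_nonneg h2 (hY n).1.le)
  nlinarith

namespace IsDriven

lemma measurableSet_exitAt (h : IsDriven P lam ν 𝓕 Y g) (n : ℕ) : MeasurableSet (exitAt c Y g n) :=
  (𝓕.le _ _ (h.measurableSet_alive n)).diff (𝓕.le _ _ (h.measurableSet_alive (n + 1)))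

lemma measurable_exitTerm (h : IsDriven P lam ν 𝓕 Y g) (n : ℕ) :
    Measurable (exitTerm c β γ κ Y g n) := by
  have h1 : Measurable (clock g n) := (h.measurable_clock n).mono (𝓕.le _) le_rfl
  have h2 : Measurable (walk c Y g n) := (h.measurable_walk n).mono (𝓕.le _) le_rfl
  have h3 := h.measurable_fst n
  have h4 : Measurable fun ω => κ ⬝ᵥ (Y n ω).2 := by unfold dotProduct; fun_prop
  exact Measurable.indicator (by fun_prop) (h.measurableSet_exitAt n)

variable [IsProbabilityMeasure P]

lemma ae_exitTerm_le (h : IsDriven P lam ν 𝓕 Y g) (hlam : 0 < lam) (hc : 0 < c) (hβ : 0 ≤ β)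
    (hγ : 0 ≤ γ) (hκ : ∀ i, 0 ≤ κ i) (hν : ∀ᵐ p ∂ν, 0 < p.1 ∧ ∀ i, 0 ≤ p.2 i) :
    ∀ᵐ ω ∂P, ∀ n, exitTerm c β γ κ Y g n ω ≤ (exitAt c Y g n).indicator (fun _ => 1) ω := by
  filter_upwards [h.ae_snd_pos hlam, h.ae_fst hlam hν] with ω h1 h2 n
  exact exitTerm_le hc hβ hγ hκ h1 h2 n

lemma integrable_exitTerm (h : IsDriven P lam ν 𝓕 Y g) (hlam : 0 < lam) (hc : 0 < c) (hβ : 0 ≤ β)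
    (hγ : 0 ≤ γ) (hκ : ∀ i, 0 ≤ κ i) (hν : ∀ᵐ p ∂ν, 0 < p.1 ∧ ∀ i, 0 ≤ p.2 i) (n : ℕ) :
    Integrable (exitTerm c β γ κ Y g n) P := by
  refine integrable_of_unit (h.measurable_exitTerm n) ?_
  filter_upwards [h.ae_exitTerm_le hlam hc hβ hγ hκ hν] with ω hω
  exact ⟨exitTerm_nonneg _ _, (hω n).trans (indicator_le_self' (fun _ _ => zero_le_one) _)⟩

/-- Exit means that the gap is at least (S_n + Y_n)/c, which has conditional probability exp(-λ(S_n
+ Y_n)/c). This merges with the discount (β+γ)/c into one rate, and the exponential factors into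
past and last jump. -/
lemma integral_exitTerm (h : IsDriven P lam ν 𝓕 Y g) (hlam : 0 < lam) (hc : 0 < c) (hβ : 0 ≤ β)
    (hγ : 0 ≤ γ) (hκ : ∀ i, 0 ≤ κ i) (hν : ∀ᵐ p ∂ν, 0 < p.1 ∧ ∀ i, 0 ≤ p.2 i) (n : ℕ) :
    ∫ ω, exitTerm c β γ κ Y g n ω ∂P =
      killedTransform P c γ Y g ((β + γ + lam) / c) n * markTransform ν ((β + γ + lam) / c) κ := by
  let f : ℝ × ℝ → ℝ × (Fin m → ℝ) → ℝ → ℝ := fun s y t => s.1 *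
    (Real.exp (-((β + γ) / c) * (s.2 + y.1) - κ ⬝ᵥ y.2) * if s.2 + y.1 - c * t ≤ 0 then 1 else 0)
  have hf : Measurable fun q : (ℝ × ℝ) × ((ℝ × (Fin m → ℝ)) × ℝ) => f q.1 q.2.1 q.2.2 := by
    have h4 : Measurable fun q : (ℝ × ℝ) × ((ℝ × (Fin m → ℝ)) × ℝ) => κ ⬝ᵥ q.2.1.2 := by
      unfold dotProduct; fun_prop
    have h5 : Measurable fun q : (ℝ × ℝ) × ((ℝ × (Fin m → ℝ)) × ℝ) =>
        if q.1.2 + q.2.1.1 - c * q.2.2 ≤ 0 then (1 : ℝ) else 0 :=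
      Measurable.ite (measurableSet_le (by fun_prop) (by fun_prop)) (by fun_prop) (by fun_prop)
    fun_prop
  have hs : Measurable[𝓕 n] fun ω => (weight c γ Y g n ω, walk c Y g n ω) :=
    (h.measurable_weight n).prodMk (h.measurable_walk n)
  have e1 : exitTerm c β γ κ Y g n =
      fun ω => f (weight c γ Y g n ω, walk c Y g n ω) (Y n ω) (g n ω) := by
    ext ω
    have h3 := mem_alive_succ (c := c) (Y := Y) (g := g) (n := n) (ω := ω)
    rw [walk_succ] at h3
    simp only [f, exitTerm, weight, exitAt]
    by_cases h1 : ω ∈ alive c Y g n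
    · by_cases h2 : 0 < walk c Y g n ω + (Y n ω).1 - c * g n ω
      · simp [h3, h1, h2, sub_pos.1 h2]
      · simp only [mem_sdiff, h1, h3, h2, and_false, not_false_eq_true, and_self, indicator_of_mem,
          not_lt.1 h2, if_true, mul_one, ← Real.exp_add]
        ring_nf
    · simp [h1]
  have hint := h.integrable_exitTerm hlam hc hβ hγ hκ hν n
  rw [e1] at hint
  rw [e1, h.integral_step hlam n hs hf hint, killedTransform, ← integral_mul_const]
  refine integral_congr_ae (ae_of_all _ fun ω => ?_)
  by_cases h1 : ω ∈ alive c Y g n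
  · have hu := walk_nonneg h1
    simp only [f, integral_const_mul]
    rw [mul_assoc, markTransform, ← integral_const_mul (Real.exp _)]
    congr 1
    refine integral_congr_ae ?_
    filter_upwards [hν] with y hy
    have e2 : (fun t => if walk c Y g n ω + y.1 - c * t ≤ 0 then (1 : ℝ) else 0) =
        (Ici ((walk c Y g n ω + y.1) / c)).indicator fun _ => 1 := by
      ext t
      simp only [indicator_apply, mem_Ici, div_le_iff₀ hc, tsub_le_iff_right, zero_add, mul_comm]
    rw [e2, integral_expMeasure_tail hlam (div_nonneg (add_nonneg hu hy.1.le) hc.le),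
      ← Real.exp_add, ← Real.exp_add]
    congr 1
    field_simp
    ring
  · simp [f, weight, h1]

/-- Each exit term is at most the indicator of its exit event, whose probability is the drop of
P(alive). The bound serves both for summability and for proving that the walk dies. -/
lemma sum_integral_exitTerm_le (h : IsDriven P lam ν 𝓕 Y g) (hlam : 0 < lam) (hc : 0 < c)
    (hβ : 0 ≤ β) (hγ : 0 ≤ γ) (hκ : ∀ i, 0 ≤ κ i) (hν : ∀ᵐ p ∂ν, 0 < p.1 ∧ ∀ i, 0 ≤ p.2 i)
    (k : ℕ) :
    ∑ n ∈ Finset.range k, ∫ ω, exitTerm c β γ κ Y g n ω ∂P ≤ 1 - P.real (alive c Y g k) := by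
  have h1 : ∀ n, ∫ ω, exitTerm c β γ κ Y g n ω ∂P ≤
      P.real (alive c Y g n) - P.real (alive c Y g (n + 1)) := by
    intro n
    rw [← measureReal_sdiff (alive_succ_subset n) (𝓕.le _ _ (h.measurableSet_alive (n + 1)))]
    refine (integral_mono_ae (h.integrable_exitTerm hlam hc hβ hγ hκ hν n)
      ((integrable_const 1).indicator (h.measurableSet_exitAt n))
      ((h.ae_exitTerm_le hlam hc hβ hγ hκ hν).mono fun ω hω => hω n)).trans_eq ?_
    rw [integral_indicator_const _ (h.measurableSet_exitAt n)]
    simp [exitAt]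
  refine (Finset.sum_le_sum fun n _ => h1 n).trans_eq ?_
  rw [Finset.sum_range_sub' (fun n => P.real (alive c Y g n)), alive_zero]
  simp

lemma integral_exp_clock (h : IsDriven P lam ν 𝓕 Y g) (hlam : 0 < lam) (hγ : 0 ≤ γ) (n : ℕ) :
    Integrable (fun ω => Real.exp (-γ * clock g n ω)) P ∧
      ∫ ω, Real.exp (-γ * clock g n ω) ∂P = (lam / (lam + γ)) ^ n := by
  have := h.isProbabilityMeasure hlam
  have hint : ∀ n, Integrable (fun ω => Real.exp (-γ * clock g n ω)) P := by
    intro n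
    have h1 : Measurable (clock g n) := (h.measurable_clock n).mono (𝓕.le _) le_rfl
    refine integrable_of_unit (by fun_prop) ?_
    filter_upwards [h.ae_snd_pos hlam] with ω hω
    exact ⟨(Real.exp_pos _).le, Real.exp_le_one_iff.2 (by nlinarith [clock_nonneg hω n])⟩
  refine ⟨hint n, ?_⟩
  induction n with
  | zero => simp [clock]
  | succ n ih =>
    have e1 : (fun ω => Real.exp (-γ * clock g (n + 1) ω)) =
        fun ω => Real.exp (-γ * clock g n ω) * Real.exp (-γ * g n ω) := by
      ext ω
      rw [clock_succ, mul_add, Real.exp_add]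
    have hi := hint (n + 1)
    rw [e1] at hi ⊢
    rw [h.integral_step hlam n (h.measurable_clock n)
      (f := fun s _ t => Real.exp (-γ * s) * Real.exp (-γ * t)) (by fun_prop) hi]
    simp only [integral_const_mul, integral_const, probReal_univ, one_smul,
      integral_expMeasure_exp hlam hγ, integral_mul_const, ih, pow_succ]

lemma jumpTransform_pos (h : IsDriven P lam ν 𝓕 Y g) (hlam : 0 < lam)
    (hν : ∀ᵐ p ∂ν, 0 < p.1) {θ : ℝ} (hθ : 0 ≤ θ) : 0 < jumpTransform ν θ := by
  have := h.isProbabilityMeasure hlam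
  exact integral_exp_pos (integrable_exp_jump hν hθ)

lemma killedTransform_zero (θ : ℝ) : killedTransform P c γ Y g θ 0 = 1 := by
  simp [killedTransform, weight, alive_zero, clock, walk]

/-- At a root of the Laplace exponent the killed transforms telescope. -/
lemma killedTransform_telescope (h : IsDriven P lam ν 𝓕 Y g) (hlam : 0 < lam) (hc : 0 < c)
    (hγ : 0 ≤ γ) (hν : ∀ᵐ p ∂ν, 0 < p.1) {θ : ℝ} (hθ : 0 ≤ θ)
    (hroot : lam + γ - c * θ = lam * jumpTransform ν θ) (n : ℕ) :
    jumpTransform ν ((lam + γ) / c) * killedTransform P c γ Y g ((lam + γ) / c) n =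
      jumpTransform ν θ * killedTransform P c γ Y g θ n -
      jumpTransform ν θ * killedTransform P c γ Y g θ (n + 1) := by
  have h1 := h.killedTransform_succ hlam hc hγ hν hθ n
  rw [hroot, mul_assoc] at h1
  have h2 := mul_left_cancel₀ hlam.ne' h1
  linarith

/-- For γ > 0 this gives decay before extinction is known; `killedTransform_le_alive` also covers γ
= 0, but gives decay only after extinction. -/
lemma killedTransform_le_pow (h : IsDriven P lam ν 𝓕 Y g) (hlam : 0 < lam) (hγ : 0 ≤ γ) {θ : ℝ}
    (hθ : 0 ≤ θ) (n : ℕ) : killedTransform P c γ Y g θ n ≤ (lam / (lam + γ)) ^ n := by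
  rw [← (h.integral_exp_clock hlam hγ n).2]
  refine integral_mono (h.integrable_weight_mul_exp hlam hγ hθ n)
    (h.integral_exp_clock hlam hγ n).1 fun ω => ?_
  by_cases h1 : ω ∈ alive c Y g n
  · simp only [weight, h1, indicator_of_mem]
    exact mul_le_of_le_one_right (Real.exp_pos _).le
      (Real.exp_le_one_iff.2 (by nlinarith [walk_nonneg h1]))
  · simp [weight, h1, Real.exp_nonneg]

lemma killedTransform_le_alive (h : IsDriven P lam ν 𝓕 Y g) (hlam : 0 < lam) (hγ : 0 ≤ γ) {θ : ℝ}
    (hθ : 0 ≤ θ) (n : ℕ) : killedTransform P c γ Y g θ n ≤ P.real (alive c Y g n) := by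
  have hm := 𝓕.le _ _ (h.measurableSet_alive (c := c) n)
  rw [← mul_one (P.real _), ← smul_eq_mul, ← integral_indicator_const _ hm]
  refine integral_mono_ae (h.integrable_weight_mul_exp hlam hγ hθ n)
    ((integrable_const 1).indicator hm) ?_
  filter_upwards [h.weight_mul_exp_mem hlam hγ hθ] with ω hω
  by_cases h1 : ω ∈ alive c Y g n
  · rw [indicator_of_mem h1]
    exact (hω n).2
  · simp [weight, h1]

/-- If the Laplace exponent is bounded below by a positive linear function, the walk is killed. -/
lemma measure_iInter_alive (h : IsDriven P lam ν 𝓕 Y g) (hlam : 0 < lam) (hc : 0 < c)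
    (hν : ∀ᵐ p ∂ν, 0 < p.1 ∧ ∀ i, 0 ≤ p.2 i) {δ : ℝ} (hδ : 0 < δ)
    (hψ : ∀ θ, 0 ≤ θ → δ * θ ≤ c * θ - lam + lam * jumpTransform ν θ) :
    P (⋂ n, alive c Y g n) = 0 := by
  have hν' : ∀ᵐ p ∂ν, 0 < p.1 := hν.mono fun _ hp => hp.1
  rw [← measureReal_eq_zero_iff]
  refine le_antisymm ?_ measureReal_nonneg
  have key : ∀ θ > 0, P.real (⋂ n, alive c Y g n) ≤ c / lam * θ := by
    intro θ hθ
    -- Choosing γ = ψ(θ) makes θ a root, so that the exit contributions telescope.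
    obtain ⟨γ, hγdef⟩ : ∃ γ, γ = c * θ - lam + lam * jumpTransform ν θ := ⟨_, rfl⟩
    have hγ : 0 < γ := hγdef ▸ (mul_pos hδ hθ).trans_le (hψ θ hθ.le)
    have hroot : lam + γ - c * θ = lam * jumpTransform ν θ := by rw [hγdef]; ring
    have h1 : ∀ k, P.real (⋂ n, alive c Y g n) ≤
        1 - jumpTransform ν θ * (1 - (lam / (lam + γ)) ^ k) := by
      intro k
      have h2 := h.sum_integral_exitTerm_le (κ := 0) (β := 0) hlam hc le_rfl hγ.le
        (fun _ => le_rfl) hν k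
      have h3 : ∀ n, ∫ ω, exitTerm c 0 γ 0 Y g n ω ∂P =
          jumpTransform ν θ * killedTransform P c γ Y g θ n -
          jumpTransform ν θ * killedTransform P c γ Y g θ (n + 1) := by
        intro n
        rw [h.integral_exitTerm (κ := 0) hlam hc le_rfl hγ.le (fun _ => le_rfl) hν, markTransform_zero,
          zero_add, add_comm γ, mul_comm]
        exact h.killedTransform_telescope hlam hc hγ.le hν' hθ.le hroot n
      simp_rw [h3] at h2
      rw [Finset.sum_range_sub' (fun n => jumpTransform ν θ * killedTransform P c γ Y g θ n),
        killedTransform_zero] at h2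
      have h4 : P.real (⋂ n, alive c Y g n) ≤ P.real (alive c Y g k) :=
        measureReal_mono (iInter_subset _ k)
      have h5 := h.killedTransform_le_pow (c := c) hlam hγ.le hθ.le k
      have h6 := h.jumpTransform_pos hlam hν' hθ.le
      nlinarith
    have h7 : lam / (lam + γ) < 1 := (div_lt_one (by positivity)).2 (by linarith)
    have h8 := tendsto_pow_atTop_nhds_zero_of_lt_one (by positivity) h7
    have h9 : Filter.Tendsto (fun k => 1 - jumpTransform ν θ * (1 - (lam / (lam + γ)) ^ k))
        Filter.atTop (nhds (1 - jumpTransform ν θ * (1 - 0))) :=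
      ((h8.const_sub 1).const_mul _).const_sub 1
    have h10 := ge_of_tendsto' h9 h1
    -- The limiting bound is 1 - φ(θ), and λ(1 - φ(θ)) = cθ - γ ≤ cθ.
    refine h10.trans ?_
    have h11 : c / lam * θ * lam = c * θ := by field_simp
    nlinarith
  have h1 : Filter.Tendsto (fun θ : ℝ => c / lam * θ) (nhdsWithin 0 (Ioi 0)) (nhds (c / lam * 0)) :=
    ((continuous_const_mul (c / lam)).tendsto 0).mono_left nhdsWithin_le_nhds
  rw [mul_zero] at h1
  exact ge_of_tendsto h1 (eventually_mem_nhdsWithin.mono fun θ hθ => key θ hθ)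

end IsDriven

end Exit

/-! ### Summing over the exit step -/

section ExitTransform

variable {Ω : Type*} {mΩ : MeasurableSpace Ω} {P : Measure Ω} [IsProbabilityMeasure P] {m : ℕ}
  {c β γ lam : ℝ} {ν : Measure (ℝ × (Fin m → ℝ))} {𝓕 : Filtration ℕ mΩ}
  {Y : ℕ → Ω → ℝ × (Fin m → ℝ)} {g : ℕ → Ω → ℝ} {κ : Fin m → ℝ}

/-- The exit functional, summed over the step at which the walk exits. -/
noncomputable def exitFunctional (c β γ : ℝ) (κ : Fin m → ℝ) (Y : ℕ → Ω → ℝ × (Fin m → ℝ))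
    (g : ℕ → Ω → ℝ) (ω : Ω) : ℝ := ∑' n, exitTerm c β γ κ Y g n ω

omit mΩ in
lemma exitFunctional_eq {n : ℕ} {ω : Ω} (h : ω ∈ exitAt c Y g n) :
    exitFunctional c β γ κ Y g ω = Real.exp (-γ * clock g n ω
      - (β + γ) / c * (walk c Y g n ω + (Y n ω).1) - κ ⬝ᵥ (Y n ω).2) := by
  rw [exitFunctional, tsum_eq_single n, exitTerm, indicator_of_mem h]
  intro k hk
  rw [exitTerm, indicator_of_notMem]
  intro h'
  rcases lt_or_gt_of_ne hk with hlt | hlt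
  · exact h'.2 (alive_antitone (Nat.succ_le_of_lt hlt) h.1)
  · exact h.2 (alive_antitone (Nat.succ_le_of_lt hlt) h'.1)

namespace IsDriven

lemma hasSum_exit (h : IsDriven P lam ν 𝓕 Y g) (hlam : 0 < lam) (hc : 0 < c) (hβ : 0 ≤ β)
    (hγ : 0 ≤ γ) (hκ : ∀ i, 0 ≤ κ i) (hν : ∀ᵐ p ∂ν, 0 < p.1 ∧ ∀ i, 0 ≤ p.2 i) :
    HasSum (fun n => killedTransform P c γ Y g ((β + γ + lam) / c) n *
      markTransform ν ((β + γ + lam) / c) κ) (∫ ω, exitFunctional c β γ κ Y g ω ∂P) := by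
  simp_rw [← h.integral_exitTerm hlam hc hβ hγ hκ hν]
  refine hasSum_integral_of_summable_integral_norm
    (h.integrable_exitTerm hlam hc hβ hγ hκ hν) ?_
  simp_rw [Real.norm_of_nonneg (exitTerm_nonneg _ _)]
  refine summable_of_sum_range_le (c := 1) (fun n => integral_nonneg (exitTerm_nonneg n)) fun k => ?_
  exact (h.sum_integral_exitTerm_le hlam hc hβ hγ hκ hν k).trans
    (sub_le_self _ measureReal_nonneg)

/-- The joint exit transform in terms of the transform of the exit time. -/
lemma integral_exitFunctional (h : IsDriven P lam ν 𝓕 Y g) (hlam : 0 < lam) (hc : 0 < c)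
    (hβ : 0 ≤ β) (hγ : 0 ≤ γ) (hκ : ∀ i, 0 ≤ κ i) (hν : ∀ᵐ p ∂ν, 0 < p.1 ∧ ∀ i, 0 ≤ p.2 i) :
    ∫ ω, exitFunctional c β γ κ Y g ω ∂P =
      (β + lam * ∫ ω, exitFunctional c 0 γ 0 Y g ω ∂P) *
        markTransform ν ((β + γ + lam) / c) κ /
          (β + lam * jumpTransform ν ((β + γ + lam) / c)) := by
  have hν' : ∀ᵐ p ∂ν, 0 < p.1 := hν.mono fun _ hp => hp.1
  obtain ⟨θ, hθdef⟩ : ∃ θ, θ = (β + γ + lam) / c := ⟨_, rfl⟩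
  have hθ : 0 ≤ θ := hθdef ▸ by positivity
  have hφ := h.jumpTransform_pos hlam hν' hθ
  have hsum := h.hasSum_exit (κ := 0) hlam hc hβ hγ (fun _ => le_rfl) hν
  have hsum0 := h.hasSum_exit (κ := 0) (β := 0) hlam hc le_rfl hγ (fun _ => le_rfl) hν
  have hsumκ := h.hasSum_exit hlam hc hβ hγ hκ hν
  rw [← hθdef] at hsum hsumκ ⊢
  rw [markTransform_zero] at hsum hsum0
  rw [zero_add, add_comm γ] at hsum0
  have hW : Summable (killedTransform P c γ Y g θ) :=
    (summable_mul_right_iff hφ.ne').1 hsum.summable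
  have hs := hW.hasSum
  have e1 := hsumκ.unique (hs.mul_right _)
  -- The recursion is summed over n. Its left side is a shifted series, which lacks the term K_0 =
  -- 1.
  have h1 : HasSum (fun n => -β * killedTransform P c γ Y g θ (n + 1))
      (-β * (∑' n, killedTransform P c γ Y g θ n - 1)) := by
    refine HasSum.mul_left _ ?_
    have := (hasSum_nat_add_iff' (f := killedTransform P c γ Y g θ) 1).2 hs
    simpa [killedTransform_zero] using this
  have h2 := ((hs.mul_left (jumpTransform ν θ)).sub hsum0).mul_left lam
  have e2 : (-β * (∑' n, killedTransform P c γ Y g θ n - 1)) =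
      lam * (jumpTransform ν θ * ∑' n, killedTransform P c γ Y g θ n -
        ∫ ω, exitFunctional c 0 γ 0 Y g ω ∂P) := by
    refine h1.unique ?_
    convert! h2 using 1
    funext n
    have h3 := h.killedTransform_succ hlam hc hγ hν' hθ n
    -- The exit rate θ = (β+γ+λ)/c turns the coefficient of the recursion into -β.
    have h4 : lam + γ - c * θ = -β := by
      rw [hθdef]
      field_simp
      ring
    rw [h4] at h3
    rw [h3, mul_comm (jumpTransform ν ((lam + γ) / c))]
  rw [e1, eq_div_iff (by positivity)]
  linear_combination (markTransform ν θ κ) * (-e2)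

/-- The transform of the exit time at a root of the Laplace exponent. -/
lemma integral_exitFunctional_root (h : IsDriven P lam ν 𝓕 Y g) (hlam : 0 < lam) (hc : 0 < c)
    (hγ : 0 ≤ γ) (hν : ∀ᵐ p ∂ν, 0 < p.1 ∧ ∀ i, 0 ≤ p.2 i)
    (hdead : P (⋂ n, alive c Y g n) = 0) {θ : ℝ} (hθ : 0 ≤ θ)
    (hroot : lam + γ - c * θ = lam * jumpTransform ν θ) :
    ∫ ω, exitFunctional c 0 γ 0 Y g ω ∂P = jumpTransform ν θ := by
  have hν' : ∀ᵐ p ∂ν, 0 < p.1 := hν.mono fun _ hp => hp.1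
  have hsum0 := h.hasSum_exit (κ := 0) (β := 0) hlam hc le_rfl hγ (fun _ => le_rfl) hν
  have e0 : ∀ n, killedTransform P c γ Y g ((0 + γ + lam) / c) n *
      markTransform ν ((0 + γ + lam) / c) 0 =
      jumpTransform ν θ * killedTransform P c γ Y g θ n -
      jumpTransform ν θ * killedTransform P c γ Y g θ (n + 1) := by
    intro n
    rw [markTransform_zero, zero_add, add_comm γ, mul_comm]
    exact h.killedTransform_telescope hlam hc hγ hν' hθ hroot n
  simp_rw [e0] at hsum0
  have h1 := hsum0.tendsto_sum_nat
  simp_rw [Finset.sum_range_sub' (fun n => jumpTransform ν θ * killedTransform P c γ Y g θ n),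
    killedTransform_zero] at h1
  have h2 : Filter.Tendsto (fun n => P.real (alive c Y g n)) Filter.atTop (nhds 0) := by
    have := tendsto_measure_iInter_atTop (μ := P)
      (fun n => (𝓕.le _ _ (h.measurableSet_alive (c := c) n)).nullMeasurableSet) alive_antitone
      ⟨0, measure_ne_top _ _⟩
    rw [hdead] at this
    exact (ENNReal.tendsto_toReal ENNReal.zero_ne_top).comp this
  have h3 : Filter.Tendsto (killedTransform P c γ Y g θ) Filter.atTop (nhds 0) :=
    squeeze_zero (fun n => integral_nonneg fun _ =>
      mul_nonneg (weight_nonneg _ _) (Real.exp_pos _).le)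
      (h.killedTransform_le_alive hlam hγ hθ) h2
  have h4 := (h3.const_mul (jumpTransform ν θ)).const_sub (jumpTransform ν θ * 1)
  simpa using tendsto_nhds_unique h1 h4

omit [IsProbabilityMeasure P] in
lemma ae_exists_exitAt (hdead : P (⋂ n, alive c Y g n) = 0) :
    ∀ᵐ ω ∂P, ∃ n, ω ∈ exitAt c Y g n := by
  have h0 : ∀ᵐ ω ∂P, ω ∉ ⋂ n, alive c Y g n := measure_eq_zero_iff_ae_notMem.1 hdead
  filter_upwards [h0] with ω hω
  by_contra! hcon
  refine hω (mem_iInter.2 fun n => ?_)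
  induction n with
  | zero => simp [alive_zero]
  | succ n ih => exact not_not.1 fun h' => hcon n ⟨ih, h'⟩

/-- The walk almost surely does not hit zero exactly at the end of a gap. -/
lemma ae_walk_ne_zero (h : IsDriven P lam ν 𝓕 Y g) (hlam : 0 < lam) (hc : 0 < c) :
    ∀ᵐ ω ∂P, ∀ n, walk c Y g (n + 1) ω ≠ 0 := by
  rw [ae_all_iff]
  intro n
  let f : ℝ → ℝ × (Fin m → ℝ) → ℝ → ℝ := fun s y t => if s + y.1 - c * t = 0 then 1 else 0
  have hf : Measurable fun q : ℝ × ((ℝ × (Fin m → ℝ)) × ℝ) => f q.1 q.2.1 q.2.2 :=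
    Measurable.ite (measurableSet_eq_fun (by fun_prop) (by fun_prop)) (by fun_prop) (by fun_prop)
  have h2 : Measurable (walk c Y g (n + 1)) :=
    (h.measurable_walk (n + 1)).mono (𝓕.le _) le_rfl
  have hm : MeasurableSet {ω | walk c Y g (n + 1) ω = 0} := h2 (measurableSet_singleton 0)
  have e1 : (fun ω => f (walk c Y g n ω) (Y n ω) (g n ω)) =
      {ω | walk c Y g (n + 1) ω = 0}.indicator fun _ => 1 := by
    ext ω
    simp [f, indicator_apply, walk_succ]
  have hint : Integrable (fun ω => f (walk c Y g n ω) (Y n ω) (g n ω)) P := by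
    rw [e1]
    exact (integrable_const 1).indicator hm
  have h3 := h.integral_step hlam n (h.measurable_walk n) hf hint
  -- For fixed past and jump, a single gap length brings the walk to 0, and the exponential law has
  -- no atoms.
  have e2 : ∀ s y, ∫ t, f s y t ∂(expMeasure lam) = 0 := by
    intro s y
    refine integral_eq_zero_of_ae ?_
    filter_upwards [measure_eq_zero_iff_ae_notMem.1 (expMeasure_singleton (lam := lam)
      ((s + y.1) / c))] with t ht
    refine if_neg fun h' => ht ?_
    rw [mem_singleton_iff, eq_div_iff hc.ne']
    linarith
  simp only [e2, integral_zero] at h3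
  rw [e1, integral_indicator_const _ hm, smul_eq_mul, mul_one, measureReal_eq_zero_iff] at h3
  exact measure_eq_zero_iff_ae_notMem.1 h3

end IsDriven

end ExitTransform

/-! ### The Laplace transform of the process at time 1 -/

section CompoundPoisson

variable {Ω : Type*} {mΩ : MeasurableSpace Ω} {P : Measure Ω} {m : ℕ}
  {c lam : ℝ} {ν : Measure (ℝ × (Fin m → ℝ))} {𝓕 : Filtration ℕ mΩ}
  {Y : ℕ → Ω → ℝ × (Fin m → ℝ)} {g : ℕ → Ω → ℝ}

/-- The sum of the first `n` jumps. -/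
noncomputable def jumpSum (Y : ℕ → Ω → ℝ × (Fin m → ℝ)) (n : ℕ) (ω : Ω) : ℝ :=
  ∑ i ∈ Finset.range n, (Y i ω).1

/-- The event that exactly `n` gaps are completed by time `1`. -/
def countAt (g : ℕ → Ω → ℝ) (n : ℕ) : Set Ω := {ω | clock g n ω ≤ 1 ∧ 1 < clock g (n + 1) ω}

/-- The exponential of the compound Poisson variable on the event of `n` jumps. -/
noncomputable def countTerm (θ : ℝ) (Y : ℕ → Ω → ℝ × (Fin m → ℝ)) (g : ℕ → Ω → ℝ) (n : ℕ) : Ω → ℝ :=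
  (countAt g n).indicator fun ω => Real.exp (-θ * jumpSum Y n ω)

/-- The tilted moments of the time remaining until `1`. -/
noncomputable def tiltedMoment (lam θ : ℝ) (Y : ℕ → Ω → ℝ × (Fin m → ℝ)) (g : ℕ → Ω → ℝ)
    (n k : ℕ) : Ω → ℝ :=
  {ω | clock g n ω ≤ 1}.indicator fun ω =>
    Real.exp (-θ * jumpSum Y n ω) * Real.exp (lam * clock g n ω) * (1 - clock g n ω) ^ k

lemma jumpSum_succ (n : ℕ) (ω : Ω) : jumpSum Y (n + 1) ω = jumpSum Y n ω + (Y n ω).1 :=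
  Finset.sum_range_succ _ _

lemma jumpSum_nonneg {ω : Ω} (hY : ∀ n, 0 < (Y n ω).1) (n : ℕ) : 0 ≤ jumpSum Y n ω :=
  Finset.sum_nonneg fun i _ => (hY i).le

lemma exp_neg_jumpSum_le {ω : Ω} (hY : ∀ n, 0 < (Y n ω).1) {θ : ℝ} (hθ : 0 ≤ θ) (n : ℕ) :
    Real.exp (-θ * jumpSum Y n ω) ≤ 1 :=
  Real.exp_le_one_iff.2 (by nlinarith [jumpSum_nonneg hY n])

namespace IsDriven

lemma measurable_jumpSum (h : IsDriven P lam ν 𝓕 Y g) (n : ℕ) : Measurable[𝓕 n] (jumpSum Y n) := by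
  unfold jumpSum
  refine Finset.measurable_fun_sum _ fun i hi => ?_
  exact _root_.measurable_fst.comp
    ((h.meas_fst i).mono (𝓕.mono (Finset.mem_range.1 hi)) le_rfl)

lemma measurable_tiltedMoment (h : IsDriven P lam ν 𝓕 Y g) (θ : ℝ) (n k : ℕ) :
    Measurable (tiltedMoment lam θ Y g n k) := by
  have h1 : Measurable (clock g n) := (h.measurable_clock n).mono (𝓕.le _) le_rfl
  have h2 : Measurable (jumpSum Y n) := (h.measurable_jumpSum n).mono (𝓕.le _) le_rfl
  exact Measurable.indicator (by fun_prop) (measurableSet_le h1 (by fun_prop))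

lemma measurable_countTerm (h : IsDriven P lam ν 𝓕 Y g) (θ : ℝ) (n : ℕ) :
    Measurable (countTerm θ Y g n) := by
  have h1 : ∀ n, Measurable (clock g n) := fun n => (h.measurable_clock n).mono (𝓕.le _) le_rfl
  have h2 : Measurable (jumpSum Y n) := (h.measurable_jumpSum n).mono (𝓕.le _) le_rfl
  exact Measurable.indicator (by fun_prop)
    ((measurableSet_le (h1 n) (by fun_prop)).inter (measurableSet_lt (by fun_prop) (h1 (n + 1))))

variable [IsProbabilityMeasure P]

lemma integrable_tiltedMoment (h : IsDriven P lam ν 𝓕 Y g) (hlam : 0 < lam)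
    (hν : ∀ᵐ p ∂ν, 0 < p.1) {θ : ℝ} (hθ : 0 ≤ θ) (n k : ℕ) :
    Integrable (tiltedMoment lam θ Y g n k) P := by
  refine Integrable.of_bound (h.measurable_tiltedMoment θ n k).aestronglyMeasurable
    (Real.exp lam) ?_
  filter_upwards [h.ae_snd_pos hlam, h.ae_fst hlam hν] with ω h1 h2
  have h3 := clock_nonneg h1 n
  unfold tiltedMoment
  by_cases h4 : clock g n ω ≤ 1
  · rw [indicator_of_mem (by exact h4), Real.norm_of_nonneg
      (mul_nonneg (by positivity) (pow_nonneg (by linarith) _)), mul_assoc, ← one_mul (Real.exp lam),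
      ← mul_one (Real.exp lam)]
    refine mul_le_mul (exp_neg_jumpSum_le h2 hθ n) (mul_le_mul (Real.exp_le_exp.2 ?_)
      (pow_le_one₀ (by linarith) (by linarith)) (pow_nonneg (by linarith) _) (Real.exp_pos _).le)
      (mul_nonneg (Real.exp_pos _).le (pow_nonneg (by linarith) _)) zero_le_one
    exact mul_le_of_le_one_right hlam.le h4
  · rw [indicator_of_notMem (by exact h4), norm_zero]
    exact (Real.exp_pos _).le

/-- Integrating out the last gap, with its density cancelled by the tilt, replaces (n+1, k) by (n,
k+1) at the price of λ φ(θ)/(k+1). Induction on n must therefore keep k general. -/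
lemma integral_tiltedMoment (h : IsDriven P lam ν 𝓕 Y g) (hlam : 0 < lam)
    (hν : ∀ᵐ p ∂ν, 0 < p.1) {θ : ℝ} (hθ : 0 ≤ θ) (n k : ℕ) :
    ∫ ω, tiltedMoment lam θ Y g n k ω ∂P =
      (lam * jumpTransform ν θ) ^ n * k.factorial / (n + k).factorial := by
  induction n generalizing k with
  | zero =>
    have : (k.factorial : ℝ) ≠ 0 := by positivity
    simp [tiltedMoment, clock, jumpSum, this]
  | succ n ih =>
    let f : ℝ × ℝ → ℝ × (Fin m → ℝ) → ℝ → ℝ := fun s y t =>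
      Real.exp (-θ * s.2) * Real.exp (lam * s.1) * (Real.exp (-θ * y.1) *
        if t ≤ 1 - s.1 then Real.exp (lam * t) * (1 - s.1 - t) ^ k else 0)
    have hf : Measurable fun q : (ℝ × ℝ) × ((ℝ × (Fin m → ℝ)) × ℝ) => f q.1 q.2.1 q.2.2 := by
      have h5 : Measurable fun q : (ℝ × ℝ) × ((ℝ × (Fin m → ℝ)) × ℝ) =>
          if q.2.2 ≤ 1 - q.1.1 then Real.exp (lam * q.2.2) * (1 - q.1.1 - q.2.2) ^ k else 0 :=
        Measurable.ite (measurableSet_le (by fun_prop) (by fun_prop)) (by fun_prop) (by fun_prop)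
      fun_prop
    have e1 : tiltedMoment lam θ Y g (n + 1) k =
        fun ω => f (clock g n ω, jumpSum Y n ω) (Y n ω) (g n ω) := by
      ext ω
      simp only [tiltedMoment, indicator_apply, f, clock_succ, jumpSum_succ, mem_ofPred_eq,
        le_sub_iff_add_le', mul_add, Real.exp_add]
      split_ifs
      · ring
      · simp
    have hint := h.integrable_tiltedMoment hlam hν hθ (n + 1) k
    rw [e1] at hint
    rw [e1, h.integral_step hlam n ((h.measurable_clock n).prodMk (h.measurable_jumpSum n)) hf hint]
    have e2 : ∀ᵐ ω ∂P, ∫ y, ∫ t, f (clock g n ω, jumpSum Y n ω) y t ∂(expMeasure lam) ∂ν =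
        lam * jumpTransform ν θ / (k + 1) * tiltedMoment lam θ Y g n (k + 1) ω := by
      refine ae_of_all _ fun ω => ?_
      simp only [f, integral_const_mul, integral_mul_const, tiltedMoment, indicator_apply,
        mem_ofPred_eq]
      have e3 : (fun t => if t ≤ 1 - clock g n ω then
          Real.exp (lam * t) * (1 - clock g n ω - t) ^ k else 0) =
          (Iic (1 - clock g n ω)).indicator fun t =>
            Real.exp (lam * t) * (1 - clock g n ω - t) ^ k := by
        ext t
        simp [indicator_apply]
      rw [e3]
      split_ifs with h1
      · rw [integral_expMeasure_pow hlam (by linarith), jumpTransform]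
        ring
      -- If time 1 has already passed, the remaining time is negative and no positive gap fits in
      -- it.
      · rw [integral_expMeasure hlam, setIntegral_eq_zero_of_forall_eq_zero]
        · simp
        · intro t ht
          rw [indicator_of_notMem, mul_zero]
          simp only [mem_Iic, mem_Ioi] at ht ⊢
          linarith
    rw [integral_congr_ae e2, integral_const_mul, ih (k + 1), Nat.factorial_succ k,
      show n + (k + 1) = n + 1 + k by ring]
    push_cast
    field_simp
    ring

lemma integrable_countTerm (h : IsDriven P lam ν 𝓕 Y g) (hlam : 0 < lam)
    (hν : ∀ᵐ p ∂ν, 0 < p.1) {θ : ℝ} (hθ : 0 ≤ θ) (n : ℕ) :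
    Integrable (countTerm θ Y g n) P := by
  refine integrable_of_unit (h.measurable_countTerm θ n) ?_
  filter_upwards [h.ae_fst hlam hν] with ω h2
  exact ⟨indicator_nonneg (fun _ _ => (Real.exp_pos _).le) _,
    indicator_apply_le' (fun _ => exp_neg_jumpSum_le h2 hθ n) fun _ => zero_le_one⟩

/-- Given T_n ≤ 1, the next gap exceeds 1 - T_n with probability exp(-λ) exp(λ T_n); this is the
tilt of `tiltedMoment` with k = 0, and Poisson weights result. -/
lemma integral_countTerm (h : IsDriven P lam ν 𝓕 Y g) (hlam : 0 < lam)
    (hν : ∀ᵐ p ∂ν, 0 < p.1) {θ : ℝ} (hθ : 0 ≤ θ) (n : ℕ) :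
    ∫ ω, countTerm θ Y g n ω ∂P =
      Real.exp (-lam) * ((lam * jumpTransform ν θ) ^ n / n.factorial) := by
  have := h.isProbabilityMeasure hlam
  let f : ℝ × ℝ → ℝ × (Fin m → ℝ) → ℝ → ℝ := fun s _ t =>
    (if s.1 ≤ 1 then Real.exp (-θ * s.2) else 0) * if 1 - s.1 < t then 1 else 0
  have hf : Measurable fun q : (ℝ × ℝ) × ((ℝ × (Fin m → ℝ)) × ℝ) => f q.1 q.2.1 q.2.2 :=
    (Measurable.ite (measurableSet_le (by fun_prop) (by fun_prop)) (by fun_prop) (by fun_prop)).mul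
    (Measurable.ite (measurableSet_lt (by fun_prop) (by fun_prop)) (by fun_prop) (by fun_prop))
  have e1 : countTerm θ Y g n =
      fun ω => f (clock g n ω, jumpSum Y n ω) (Y n ω) (g n ω) := by
    ext ω
    simp only [countTerm, countAt, indicator_apply, f, clock_succ, mem_ofPred_eq,
      sub_lt_iff_lt_add']
    by_cases h1 : clock g n ω ≤ 1 <;> by_cases h2 : 1 < clock g n ω + g n ω <;> simp [h1, h2]
  have hint := h.integrable_countTerm hlam hν hθ n
  rw [e1] at hint
  rw [e1, h.integral_step hlam n ((h.measurable_clock n).prodMk (h.measurable_jumpSum n)) hf hint]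
  have e2 : ∀ ω, ∫ y, ∫ t, f (clock g n ω, jumpSum Y n ω) y t ∂(expMeasure lam) ∂ν =
      Real.exp (-lam) * tiltedMoment lam θ Y g n 0 ω := by
    intro ω
    simp only [f, integral_const_mul, tiltedMoment, indicator_apply, mem_ofPred_eq,
      integral_const, probReal_univ, one_smul, pow_zero, mul_one]
    split_ifs with h1
    · have e3 : (fun t => if 1 - clock g n ω < t then (1 : ℝ) else 0) =
          (Ioi (1 - clock g n ω)).indicator fun _ => 1 := by
        ext t
        simp [indicator_apply]
      rw [e3, integral_expMeasure_tail_lt hlam (by linarith)]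
      simp only [← Real.exp_add]
      ring_nf
    · simp
  simp_rw [e2]
  rw [integral_const_mul, h.integral_tiltedMoment hlam hν hθ]
  simp

/-- Markov's inequality for exp(-T_k) bounds P(T_k ≤ 1) by a geometric sequence, so the epochs
almost surely pass time 1. -/
lemma ae_exists_countAt (h : IsDriven P lam ν 𝓕 Y g) (hlam : 0 < lam) :
    ∀ᵐ ω ∂P, ∃ n, ω ∈ countAt g n := by
  have h0 : P (⋂ n, {ω | clock g n ω ≤ 1}) = 0 := by
    rw [← measureReal_eq_zero_iff]
    refine le_antisymm ?_ measureReal_nonneg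
    have h1 : ∀ k, P.real (⋂ n, {ω | clock g n ω ≤ 1}) ≤ Real.exp 1 * (lam / (lam + 1)) ^ k := by
      intro k
      have hm : MeasurableSet {ω | clock g k ω ≤ 1} :=
        measurableSet_le ((h.measurable_clock k).mono (𝓕.le _) le_rfl) (by fun_prop)
      refine (measureReal_mono (iInter_subset _ k)).trans ?_
      obtain ⟨h2, h3⟩ := h.integral_exp_clock hlam zero_le_one k
      rw [← h3, ← integral_const_mul, ← mul_one (P.real _), ← smul_eq_mul,
        ← integral_indicator_const _ hm]
      refine integral_mono ((integrable_const 1).indicator hm) (h2.const_mul _) fun ω => ?_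
      refine indicator_apply_le' (fun h4 => ?_) fun _ => by positivity
      rw [← Real.exp_add]
      exact Real.one_le_exp (by simp only [mem_ofPred_eq] at h4; linarith)
    have h8 := (tendsto_pow_atTop_nhds_zero_of_lt_one (r := lam / (lam + 1)) (by positivity)
      ((div_lt_one (by positivity)).2 (by linarith))).const_mul (Real.exp 1)
    rw [mul_zero] at h8
    exact ge_of_tendsto' h8 h1
  filter_upwards [measure_eq_zero_iff_ae_notMem.1 h0] with ω hω
  by_contra! hcon
  refine hω (mem_iInter.2 fun n => ?_)
  induction n with
  | zero => simp [clock]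
  | succ n ih => exact not_lt.1 fun h' => hcon n ⟨ih, h'⟩

/-- The Laplace transform of the compound Poisson variable at time `1`. -/
lemma integral_exp_compoundPoisson (h : IsDriven P lam ν 𝓕 Y g) (hlam : 0 < lam)
    (hν : ∀ᵐ p ∂ν, 0 < p.1) {θ : ℝ} (hθ : 0 ≤ θ) {X : Ω → ℝ}
    (hX : ∀ᵐ ω ∂P, ∀ n, ω ∈ countAt g n → X ω = -c + jumpSum Y n ω) :
    ∫ ω, Real.exp (-θ * X ω) ∂P = Real.exp (c * θ - lam + lam * jumpTransform ν θ) := by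
  have h1 : HasSum (fun n => ∫ ω, countTerm θ Y g n ω ∂P)
      (Real.exp (-lam) * Real.exp (lam * jumpTransform ν θ)) := by
    simp_rw [h.integral_countTerm hlam hν hθ]
    refine HasSum.mul_left _ ?_
    rw [Real.exp_eq_exp_ℝ]
    exact NormedSpace.expSeries_div_hasSum_exp (lam * jumpTransform ν θ)
  have hnn : ∀ n ω, 0 ≤ countTerm θ Y g n ω :=
    fun n ω => indicator_nonneg (fun _ _ => (Real.exp_pos _).le) _
  have h2 := hasSum_integral_of_summable_integral_norm (h.integrable_countTerm hlam hν hθ)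
    (by simpa only [Real.norm_of_nonneg (hnn _ _)] using h1.summable)
  -- The events of exactly n jumps are disjoint and almost surely exhaustive, so one term of the
  -- series survives.
  have h3 : ∀ᵐ ω ∂P, Real.exp (-θ * X ω) = Real.exp (c * θ) * ∑' n, countTerm θ Y g n ω := by
    filter_upwards [hX, h.ae_exists_countAt hlam, h.ae_snd_pos hlam] with ω hω ⟨n, hn⟩ hg
    have hmono : Monotone fun n => clock g n ω :=
      monotone_nat_of_le_succ fun n => by rw [clock_succ]; linarith [hg n]
    rw [tsum_eq_single n, countTerm, indicator_of_mem hn, hω n hn, ← Real.exp_add]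
    · ring_nf
    · intro k hk
      rw [countTerm, indicator_of_notMem]
      intro h'
      rcases lt_or_gt_of_ne hk with hlt | hlt
      · exact absurd (h'.2.trans_le (hmono (Nat.succ_le_of_lt hlt))) (not_lt.2 hn.1)
      · exact absurd (hn.2.trans_le (hmono (Nat.succ_le_of_lt hlt))) (not_lt.2 h'.1)
  rw [integral_congr_ae h3, integral_const_mul, h2.unique h1, ← Real.exp_add, ← Real.exp_add]
  ring_nf

end IsDriven

end CompoundPoisson

/-! ### From the walk back to the path -/

section Path

/-- The first and third cases concern the default of `leftLim`, the value of the function itself: at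
points with no left neighbourhood, such as 0, and where no left limit exists. -/
lemma leftLim_const_add (x : ℝ) (z : ℝ≥0 → ℝ) (t : ℝ≥0) :
    Function.leftLim (fun s => x + z s) t = x + Function.leftLim z t := by
  by_cases h : nhdsWithin t (Iio t) = ⊥
  · rw [leftLim_eq_of_eq_bot _ h, leftLim_eq_of_eq_bot _ h]
  by_cases h' : ∃ y, Filter.Tendsto z (nhdsWithin t (Iio t)) (nhds y)
  · obtain ⟨y, hy⟩ := h'
    have : (nhdsWithin t (Iio t)).NeBot := ⟨h⟩
    rw [leftLim_eq_of_tendsto hy, leftLim_eq_of_tendsto (hy.const_add x)]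
  · rw [leftLim_eq_of_not_tendsto _ h', leftLim_eq_of_not_tendsto]
    rintro ⟨y, hy⟩
    exact h' ⟨-x + y, by simpa using hy.const_add (-x)⟩

lemma jumpEpoch_const_add (x : ℝ) (z : ℝ≥0 → ℝ) (n : ℕ) :
    jumpEpoch (fun s => x + z s) n = jumpEpoch z n := by
  induction n with
  | zero => rfl
  | succ n ih => simp only [jumpEpoch, ih, leftLim_const_add, ne_eq, add_right_inj]

variable {z : ℝ≥0 → ℝ} {c : ℝ}

lemma exists_jumpEpoch_le_lt {t : ℝ≥0} {n : ℕ} (h : t < jumpEpoch z (n + 1)) :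
    ∃ k ≤ n, jumpEpoch z k ≤ t ∧ t < jumpEpoch z (k + 1) := by
  induction n with
  | zero => exact ⟨0, le_rfl, zero_le, h⟩
  | succ n ih =>
    by_cases h' : t < jumpEpoch z (n + 1)
    · obtain ⟨k, hk, h1⟩ := ih h'
      exact ⟨k, hk.trans n.le_succ, h1⟩
    · exact ⟨n + 1, le_rfl, not_lt.1 h', h⟩

lemma leftLim_jumpEpoch (hT : ∀ n, jumpEpoch z n < jumpEpoch z (n + 1))
    (hpath : ∀ (n : ℕ) (t : ℝ≥0), jumpEpoch z n ≤ t → t < jumpEpoch z (n + 1) →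
      z t = -c * t + ∑ i ∈ Finset.range n, jumpSize z (i + 1)) (n : ℕ) :
    Function.leftLim z (jumpEpoch z (n + 1)) =
      -c * jumpEpoch z (n + 1) + ∑ i ∈ Finset.range n, jumpSize z (i + 1) := by
  have : (nhdsWithin (jumpEpoch z (n + 1)) (Iio (jumpEpoch z (n + 1)))).NeBot :=
    nhdsLT_neBot_of_exists_lt ⟨_, hT n⟩
  have h1 : Continuous fun t : ℝ≥0 =>
      -c * (t : ℝ) + ∑ i ∈ Finset.range n, jumpSize z (i + 1) := by fun_prop
  refine leftLim_eq_of_tendsto (((h1.tendsto _).mono_left nhdsWithin_le_nhds).congr' ?_)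
  filter_upwards [Ioo_mem_nhdsLT (hT n)] with t ht
  exact (hpath n t ht.1.le ht.2).symm

variable {Ω : Type*} {m : ℕ} {Y : ℕ → Ω → ℝ × (Fin m → ℝ)} {g : ℕ → Ω → ℝ} {ω : Ω} {x : ℝ}

lemma clock_eq_jumpEpoch
    (hg : ∀ n, g n ω = (jumpEpoch z (n + 1) : ℝ) - jumpEpoch z n) (n : ℕ) :
    clock g n ω = jumpEpoch z n := by
  simp only [clock, hg]
  rw [Finset.sum_range_sub (fun n => (jumpEpoch z n : ℝ))]
  simp [jumpEpoch]

/-- Both sides are the level right after jump n. The index shifts by one because the start is entry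
0 of `Y`. -/
lemma walk_add_eq (hY0 : (Y 0 ω).1 = x) (hY : ∀ n, (Y (n + 1) ω).1 = jumpSize z (n + 1))
    (hg : ∀ n, g n ω = (jumpEpoch z (n + 1) : ℝ) - jumpEpoch z n) (n : ℕ) :
    walk c Y g n ω + (Y n ω).1 =
      x + (-c * jumpEpoch z n + ∑ i ∈ Finset.range n, jumpSize z (i + 1)) := by
  have h1 : walk c Y g n ω + (Y n ω).1 =
      (∑ i ∈ Finset.range (n + 1), (Y i ω).1) - c * clock g n ω := by
    rw [walk, Finset.sum_sub_distrib, ← Finset.mul_sum, Finset.sum_range_succ, clock]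
    ring
  rw [h1, clock_eq_jumpEpoch hg, Finset.sum_range_succ', hY0]
  simp only [hY]
  ring

/-- On the exit event the path of the process hits zero after the corresponding jump. -/
lemma hitZero_of_mem_exitAt (hc : 0 < c) (hT : ∀ n, jumpEpoch z n < jumpEpoch z (n + 1))
    (hpath : ∀ (n : ℕ) (t : ℝ≥0), jumpEpoch z n ≤ t → t < jumpEpoch z (n + 1) →
      z t = -c * t + ∑ i ∈ Finset.range n, jumpSize z (i + 1))
    (hYpos : ∀ n, 0 < (Y n ω).1)
    (hY0 : (Y 0 ω).1 = x) (hY : ∀ n, (Y (n + 1) ω).1 = jumpSize z (n + 1))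
    (hg : ∀ n, g n ω = (jumpEpoch z (n + 1) : ℝ) - jumpEpoch z n)
    {n : ℕ} (hne : walk c Y g (n + 1) ω ≠ 0) (hn : ω ∈ exitAt c Y g n) :
    lastJump (fun t => x + z t) = n ∧
      (hitZero (fun t => x + z t) : ℝ) = clock g n ω + (walk c Y g n ω + (Y n ω).1) / c ∧
      (∃ t, x + z t = 0) ∧
      Function.leftLim (fun t => x + z t) (jumpEpoch (fun t => x + z t) (n + 1)) ≤ 0 := by
  have hleft : ∀ k, Function.leftLim (fun t => x + z t) (jumpEpoch (fun t => x + z t) (k + 1)) =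
      walk c Y g (k + 1) ω := by
    intro k
    rw [jumpEpoch_const_add, leftLim_const_add, leftLim_jumpEpoch hT hpath, walk_succ,
      walk_add_eq hY0 hY hg, hg]
    ring
  have hval : ∀ k t, jumpEpoch z k ≤ t → t < jumpEpoch z (k + 1) →
      x + z t = walk c Y g (k + 1) ω + c * (jumpEpoch z (k + 1) - t) := by
    intro k t h1 h2
    rw [hpath k t h1 h2, walk_succ, walk_add_eq hY0 hY hg, hg]
    ring
  have hn' := mem_exitAt.1 hn
  have hr : 0 ≤ clock g n ω + (walk c Y g n ω + (Y n ω).1) / c := by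
    have h2 := walk_nonneg hn.1
    have h3 := hYpos n
    rw [clock_eq_jumpEpoch hg]
    positivity
  -- The candidate hitting time: from level S_n + Y_n at T_n, drift at speed c reaches 0 after (S_n
  -- + Y_n)/c.
  obtain ⟨τ, hτ⟩ : ∃ τ : ℝ≥0, (τ : ℝ) = clock g n ω + (walk c Y g n ω + (Y n ω).1) / c :=
    ⟨⟨_, hr⟩, rfl⟩
  have hcτ : c * τ = c * jumpEpoch z n + (walk c Y g n ω + (Y n ω).1) := by
    rw [hτ, clock_eq_jumpEpoch hg]
    field_simp
  have hwalk : walk c Y g (n + 1) ω = c * τ - c * jumpEpoch z (n + 1) := by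
    rw [hcτ, walk_succ, hg]
    ring
  have hτ1 : jumpEpoch z n ≤ τ := by
    have h2 := walk_nonneg hn.1
    have h3 := hYpos n
    rw [← NNReal.coe_le_coe]
    nlinarith
  -- Strictness is where `hne` enters: the path formula of gap n is valid only before T_{n+1}, when
  -- the next jump occurs.
  have hτ2 : τ < jumpEpoch z (n + 1) := by
    have h2 := lt_of_le_of_ne hn'.2 hne
    rw [← NNReal.coe_lt_coe]
    nlinarith
  have hz : x + z τ = 0 := by
    rw [hval n τ hτ1 hτ2, hwalk]
    ring
  refine ⟨?_, ?_, ⟨τ, hz⟩, (hleft n).trans_le hn'.2⟩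
  · refine IsLeast.csInf_eq ⟨(hleft n).trans_le hn'.2, fun k hk => ?_⟩
    by_contra! hlt
    have h1 : walk c Y g (k + 1) ω ≤ 0 := (hleft k).symm.trans_le hk
    exact absurd (hn'.1 k hlt) (not_lt.2 h1)
  · rw [← hτ, NNReal.coe_inj]
    refine IsLeast.csInf_eq ⟨hz, fun t ht => ?_⟩
    by_contra! hlt
    -- No earlier zero exists: in a gap k < n the path stays above S_{k+1} > 0, and in gap n it
    -- equals c(τ - t) > 0.
    obtain ⟨k, hk, h1, h2⟩ := exists_jumpEpoch_le_lt (hlt.trans hτ2)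
    have h3 : x + z t = 0 := ht
    rw [hval k t h1 h2] at h3
    rcases hk.lt_or_eq with hk | rfl
    · have h4 := hn'.1 k hk
      have h5 : (t : ℝ) < jumpEpoch z (k + 1) := NNReal.coe_lt_coe.2 h2
      nlinarith
    · have h5 : (t : ℝ) < τ := NNReal.coe_lt_coe.2 hlt
      nlinarith

end Path

/-! ### Convexity, monotonicity and inversion of the Laplace exponent -/

section LaplaceExponent

variable {m : ℕ} {c lam δ : ℝ} {ν : Measure (ℝ × (Fin m → ℝ))} [IsProbabilityMeasure ν]

/-- The Laplace exponent of the compound Poisson process in terms of the jump law. -/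
noncomputable def cumulant (c lam : ℝ) (ν : Measure (ℝ × (Fin m → ℝ))) (θ : ℝ) : ℝ :=
  c * θ - lam + lam * jumpTransform ν θ

lemma cumulant_zero : cumulant c lam ν 0 = 0 := by simp [cumulant, jumpTransform]

lemma cumulant_eq (hν : ∀ᵐ p ∂ν, 0 < p.1) {θ : ℝ} (hθ : 0 ≤ θ) :
    cumulant c lam ν θ = c * θ - lam * ∫ z, (1 - Real.exp (-θ * z)) ∂(ν.map Prod.fst) := by
  rw [integral_map measurable_fst.aemeasurable (by fun_prop),
    integral_sub (integrable_const _) (integrable_exp_jump hν hθ)]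
  simp only [integral_const, probReal_univ, one_smul, cumulant, jumpTransform]
  ring

/-- This is convexity between 0 and θ, as ψ(0) = 0. With ψ > 0 on (0, ∞) it suffices for strict
monotonicity, without derivatives. -/
lemma cumulant_mul_le (hlam : 0 < lam) (hν : ∀ᵐ p ∂ν, 0 < p.1) {θ a : ℝ} (hθ : 0 ≤ θ)
    (ha : 0 ≤ a) (ha1 : a ≤ 1) : cumulant c lam ν (a * θ) ≤ a * cumulant c lam ν θ := by
  have h1 : jumpTransform ν (a * θ) ≤ a * jumpTransform ν θ + (1 - a) := by
    have hi := (integrable_exp_jump hν hθ).const_mul a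
    have h2 : a * jumpTransform ν θ + (1 - a) = ∫ p, (a * Real.exp (-θ * p.1) + (1 - a)) ∂ν := by
      rw [integral_add hi (integrable_const _), integral_const_mul]
      simp [jumpTransform]
    rw [h2]
    refine integral_mono (integrable_exp_jump hν (mul_nonneg ha hθ))
      (hi.add (integrable_const _)) fun p => ?_
    have h3 := convexOn_exp.2 (mem_univ (-θ * p.1)) (mem_univ 0) ha (sub_nonneg.2 ha1) (by ring)
    simp only [smul_eq_mul, mul_zero, add_zero, Real.exp_zero, mul_one] at h3
    rwa [show -(a * θ) * p.1 = a * (-θ * p.1) by ring]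
  have h2 := mul_le_mul_of_nonneg_left h1 hlam.le
  simp only [cumulant]
  linarith

lemma strictMonoOn_cumulant (hlam : 0 < lam) (hν : ∀ᵐ p ∂ν, 0 < p.1) (hδ : 0 < δ)
    (hψ : ∀ θ, 0 ≤ θ → δ * θ ≤ cumulant c lam ν θ) : StrictMonoOn (cumulant c lam ν) (Ici 0) := by
  intro x hx y hy hxy
  have hy0 : 0 < y := lt_of_le_of_lt hx hxy
  have h1 := cumulant_mul_le (c := c) hlam hν hy0.le (a := x / y) (div_nonneg hx hy0.le)
    ((div_le_one hy0).2 hxy.le)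
  rw [div_mul_cancel₀ _ hy0.ne'] at h1
  exact h1.trans_lt (mul_lt_of_lt_one_left ((mul_pos hδ hy0).trans_le (hψ y hy0.le))
    ((div_lt_one hy0).2 hxy))

lemma continuousOn_cumulant (hν : ∀ᵐ p ∂ν, 0 < p.1) : ContinuousOn (cumulant c lam ν) (Ici 0) := by
  have h1 : ContinuousOn (jumpTransform ν) (Ici 0) := by
    refine continuousOn_of_dominated (bound := fun _ => 1) (fun θ _ => by fun_prop) (fun θ hθ => ?_)
      (integrable_const _) (ae_of_all _ fun p => by fun_prop)
    filter_upwards [hν] with p hp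
    rw [Real.norm_of_nonneg (Real.exp_pos _).le]
    have : 0 ≤ θ := hθ
    exact Real.exp_le_one_iff.2 (by nlinarith)
  unfold cumulant
  fun_prop

lemma bijOn_cumulant (hlam : 0 < lam) (hν : ∀ᵐ p ∂ν, 0 < p.1) (hδ : 0 < δ)
    (hψ : ∀ θ, 0 ≤ θ → δ * θ ≤ cumulant c lam ν θ) :
    BijOn (cumulant c lam ν) (Ici 0) (Ici 0) := by
  refine ⟨fun θ hθ => (mul_nonneg hδ.le hθ).trans (hψ θ hθ),
    (strictMonoOn_cumulant hlam hν hδ hψ).injOn, fun y hy => ?_⟩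
  have hy0 : 0 ≤ y / δ := div_nonneg hy hδ.le
  -- At y/δ the linear lower bound already gives ψ ≥ y, so the intermediate value theorem on [0,
  -- y/δ] yields a preimage.
  have h1 := intermediate_value_Icc hy0
    ((continuousOn_cumulant (c := c) (lam := lam) hν).mono Icc_subset_Ici_self)
  rw [cumulant_zero] at h1
  have h2 := hψ _ hy0
  rw [mul_div_cancel₀ _ hδ.ne'] at h2
  obtain ⟨θ, hθ, e⟩ := h1 ⟨hy, h2⟩
  exact ⟨θ, hθ.1, e⟩

/-- Jensen's inequality for a transform of exponential form. -/
lemma neg_integral_mul_le {Ω : Type*} [MeasurableSpace Ω] {P : Measure Ω} [IsProbabilityMeasure P]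
    {X : Ω → ℝ} (hX : Integrable X P) {θ b : ℝ}
    (h : ∫ ω, Real.exp (-θ * X ω) ∂P = Real.exp b) : -(∫ ω, X ω ∂P) * θ ≤ b := by
  have hi : Integrable (fun ω => Real.exp (-θ * X ω)) P := by
    -- A nonintegrable function has integral 0 by convention, which is not an exponential.
    by_contra hcon
    rw [integral_undef hcon] at h
    exact (Real.exp_pos b).ne h
  have hX' := hX.const_mul (-θ)
  have h1 := convexOn_exp.map_integral_le Real.continuous_exp.continuousOn isClosed_univ
    (ae_of_all _ fun ω => mem_univ _) hX' hi
  rw [h, Real.exp_le_exp, integral_const_mul] at h1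
  linarith

end LaplaceExponent

/-! ### Extracting the driving sequences from the process -/

section Driving

variable {Ω : Type*} {m : ℕ}

lemma iSup_comap_le_comap_pi {E : Type*} [MeasurableSpace E] (X : ℕ → Ω → E) :
    ⨆ n, MeasurableSpace.comap (X n) inferInstance ≤
      MeasurableSpace.comap (fun ω n => X n ω) inferInstance :=
  iSup_le fun n => measurable_iff_comap_le.1
    ((measurable_pi_apply n).comp (comap_measurable fun ω n => X n ω))

/-- The σ-algebras generated by a start `X`, gaps `g` and jumps `J`. -/
@[reducible]
def sourceAlgebra {E : Type*} [MeasurableSpace E] (X : Ω → E) (g : ℕ → Ω → ℝ) (J : ℕ → Ω → E) :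
    Unit ⊕ (ℕ ⊕ ℕ) → MeasurableSpace Ω
  | .inl _ => MeasurableSpace.comap X inferInstance
  | .inr (.inl n) => MeasurableSpace.comap (g n) inferInstance
  | .inr (.inr n) => MeasurableSpace.comap (J n) inferInstance

/-- The sequence of jumps preceded by the start. -/
def startedJumps {E : Type*} (X : Ω → E) (J : ℕ → Ω → E) : ℕ → Ω → E
  | 0 => X
  | n + 1 => J n

/-- The position of the `n`-th term of `startedJumps` among the sources. -/
def startedIndex : ℕ → Unit ⊕ (ℕ ⊕ ℕ)
  | 0 => .inl ()
  | n + 1 => .inr (.inr n)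

variable {mΩ : MeasurableSpace Ω} {P : Measure Ω} [IsProbabilityMeasure P] {c lam : ℝ}

/-- Independent sources drive two walks: one that includes the start and one that does not. -/
lemma exists_isDriven_of_measurable {E : Type*} [MeasurableSpace E] {ν : Measure E}
    {X : Ω → E} {g : ℕ → Ω → ℝ} {J : ℕ → Ω → E}
    (hX : Measurable X) (hg : ∀ n, Measurable (g n)) (hJ : ∀ n, Measurable (J n))
    (hgi : iIndepFun g P) (hJi : iIndepFun J P)
    (hgJ : IndepFun (fun ω n => g n ω) (fun ω n => J n ω) P)
    (hXi : IndepFun X (fun ω => (fun n => g n ω, fun n => J n ω)) P)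
    (hXlaw : P.map X = ν) (hglaw : ∀ n, P.map (g n) = expMeasure lam)
    (hJlaw : ∀ n, P.map (J n) = ν) :
    ∃ 𝓕 𝓖 : Filtration ℕ mΩ, IsDriven P lam ν 𝓕 (startedJumps X J) g ∧ IsDriven P lam ν 𝓖 J g := by
  have hσ : ∀ i, sourceAlgebra X g J i ≤ mΩ := by
    rintro (_ | n | n)
    · exact measurable_iff_comap_le.1 hX
    · exact measurable_iff_comap_le.1 (hg n)
    · exact measurable_iff_comap_le.1 (hJ n)
  have hind : iIndep (sourceAlgebra X g J) P := by
    refine iIndep_sum iIndep.of_subsingleton (iIndep_sum ?_ ?_ ?_) ?_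
    · exact (iIndepFun_iff_iIndep _ _ _).1 hgi
    · exact (iIndepFun_iff_iIndep _ _ _).1 hJi
    · exact indep_of_indep_of_le_left (indep_of_indep_of_le_right
        ((IndepFun_iff_Indep _ _ _).1 hgJ) (iSup_comap_le_comap_pi J)) (iSup_comap_le_comap_pi g)
    · refine indep_of_indep_of_le_left (indep_of_indep_of_le_right
        ((IndepFun_iff_Indep _ _ _).1 hXi) ?_) (iSup_le fun _ => le_rfl)
      have hpair := comap_measurable (m := Prod.instMeasurableSpace)
        fun ω => ((fun n => g n ω, fun n => J n ω) : (ℕ → ℝ) × (ℕ → E))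
      refine iSup_le ?_
      rintro (n | n)
      · exact measurable_iff_comap_le.1
          ((measurable_pi_apply n).comp (_root_.measurable_fst.comp hpair))
      · exact measurable_iff_comap_le.1
          ((measurable_pi_apply n).comp (_root_.measurable_snd.comp hpair))
  -- With the start included, the start has level 0 and process jump n has level n+1, next to gap
  -- n+1; without it, process jump n shares level n with gap n.
  refine ⟨_, _, isDriven_levelFiltration hσ hind (Sum.elim 0 (Sum.elim id Nat.succ)) startedIndex
    (fun n => .inr (.inl n)) ?_ ?_ ?_ ?_ (fun n => comap_measurable (g n)) ?_ hglaw,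
    isDriven_levelFiltration hσ hind (Sum.elim 0 (Sum.elim id id)) (fun n => .inr (.inr n))
      (fun n => .inr (.inl n)) (fun n => rfl) (fun n => rfl) (fun n => by simp)
      (fun n => comap_measurable (J n)) (fun n => comap_measurable (g n)) hJlaw hglaw⟩
  · rintro (_ | n) <;> rfl
  · exact fun n => rfl
  · rintro (_ | n) <;> simp [startedIndex]
  · rintro (_ | n)
    · exact comap_measurable X
    · exact comap_measurable (J n)
  · rintro (_ | n)
    · exact hXlaw
    · exact hJlaw n

variable {ν : Measure (ℝ × (Fin m → ℝ))} {Z : ℝ≥0 → Ω → ℝ} {M : ℕ → Ω → Fin m → ℝ} {ξ : Ω → ℝ}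

/-- Measurable modifications of the start, the marked jumps and the gaps drive two walks. -/
lemma exists_isDriven (hZ : IsMarkedCompoundPoisson P c lam ν Z M)
    (hξ : HasLaw (fun ω => (ξ ω, M 0 ω)) ν P)
    (hξ_indep : IndepFun (fun ω => (ξ ω, M 0 ω))
      (fun ω => (fun n => gap Z n ω, fun n => markedJump Z M n ω)) P) :
    ∃ (Y : ℕ → Ω → ℝ × (Fin m → ℝ)) (g : ℕ → Ω → ℝ) (𝓕 𝓖 : Filtration ℕ mΩ),
      IsDriven P lam ν 𝓕 Y g ∧ IsDriven P lam ν 𝓖 (fun n => Y (n + 1)) g ∧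
      (∀ᵐ ω ∂P, Y 0 ω = (ξ ω, M 0 ω)) ∧ (∀ᵐ ω ∂P, ∀ n, Y (n + 1) ω = markedJump Z M n ω) ∧
      ∀ᵐ ω ∂P, ∀ n, g n ω = gap Z n ω := by
  -- `HasLaw` gives only almost everywhere measurability, so measurable modifications are taken;
  -- they agree with the originals for all indices at once outside a null set.
  obtain ⟨X, hX, hXe⟩ := hξ.aemeasurable
  choose J hJ hJe using fun n => (hZ.jump_law n).aemeasurable
  choose g hg hge using fun n => (hZ.gap_law n).aemeasurable
  have hgs : (fun ω n => gap Z n ω) =ᵐ[P] fun ω n => g n ω := by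
    filter_upwards [ae_all_iff.2 hge] with ω hω
    exact funext hω
  have hJs : (fun ω n => markedJump Z M n ω) =ᵐ[P] fun ω n => J n ω := by
    filter_upwards [ae_all_iff.2 hJe] with ω hω
    exact funext hω
  obtain ⟨𝓕, 𝓖, h1, h2⟩ := exists_isDriven_of_measurable (lam := lam) hX hg hJ
    (hZ.gap_indep.congr hge) (hZ.jump_indep.congr hJe) (hZ.indep.congr hgs hJs)
    (hξ_indep.congr hXe (hgs.prodMk hJs)) (by rw [← Measure.map_congr hXe, hξ.map_eq])
    (fun n => by rw [← Measure.map_congr (hge n), (hZ.gap_law n).map_eq])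
    (fun n => by rw [← Measure.map_congr (hJe n), (hZ.jump_law n).map_eq])
  exact ⟨startedJumps X J, g, 𝓕, 𝓖, h1, h2, hXe.mono fun ω hω => hω.symm,
    (ae_all_iff.2 hJe).mono fun ω hω n => (hω n).symm,
    (ae_all_iff.2 hge).mono fun ω hω n => (hω n).symm⟩

end Driving

end MarkedCPP

/-! ### The joint transform -/

theorem propositionA1 {Ω : Type*} [MeasurableSpace Ω] (P : Measure Ω) [IsProbabilityMeasure P]
    {m : ℕ} (c lam : ℝ) (hc : 0 < c) (hlam : 0 < lam)
    (ν : Measure (ℝ × (Fin m → ℝ))) (hν : ∀ᵐ p ∂ν, 0 < p.1 ∧ ∀ i, 0 ≤ p.2 i)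
    (Z : ℝ≥0 → Ω → ℝ) (M : ℕ → Ω → Fin m → ℝ)
    (hZ : MarkedCPP.IsMarkedCompoundPoisson P c lam ν Z M)
    (hdrift : ∫ ω, Z 1 ω ∂P < 0)
    (ξ : Ω → ℝ) (hξ : HasLaw (fun ω => (ξ ω, M 0 ω)) ν P)
    (hξ_indep : IndepFun (fun ω => (ξ ω, M 0 ω))
      (fun ω => (fun n => MarkedCPP.gap Z n ω, fun n => MarkedCPP.markedJump Z M n ω)) P) :
    -- the Laplace exponent of `Z`, whose inverse on `[0, ∞)` is well defined
    (∀ θ : ℝ, 0 ≤ θ → MarkedCPP.laplaceExponent P Z θ =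
      c * θ - lam * ∫ z, (1 - Real.exp (-θ * z)) ∂(ν.map Prod.fst)) ∧
    StrictMonoOn (MarkedCPP.laplaceExponent P Z) (Ici 0) ∧
    BijOn (MarkedCPP.laplaceExponent P Z) (Ici 0) (Ici 0) ∧
    -- `τ₋` and `N₋` are almost surely finite
    (∀ᵐ ω ∂P, (∃ t, MarkedCPP.startedPath Z ξ ω t = 0) ∧
      ∃ n, Function.leftLim (MarkedCPP.startedPath Z ξ ω)
        (MarkedCPP.jumpEpoch (MarkedCPP.startedPath Z ξ ω) (n + 1)) ≤ 0) ∧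
    -- the joint transform
    ∀ (β γ : ℝ) (κ : Fin m → ℝ), 0 ≤ β → 0 ≤ γ → (∀ i, 0 ≤ κ i) →
      (∫ ω, Real.exp (-β * (MarkedCPP.tauMinus Z ξ ω - MarkedCPP.lastEpoch Z ξ ω)
          - γ * MarkedCPP.tauMinus Z ξ ω - κ ⬝ᵥ M (MarkedCPP.NMinus Z ξ ω) ω) ∂P =
        (β + γ - c * MarkedCPP.invLaplaceExponent P Z γ + lam) *
            (∫ ω, Real.exp (-(β + γ + lam) * ξ ω / c - κ ⬝ᵥ M 0 ω) ∂P) /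
          (β + lam * ∫ ω, Real.exp (-(β + γ + lam) * ξ ω / c) ∂P)) ∧
      (∫ ω, Real.exp (-β * (MarkedCPP.tauMinus Z ξ ω - MarkedCPP.lastEpoch Z ξ ω)
          - γ * MarkedCPP.tauMinus Z ξ ω - κ ⬝ᵥ M (MarkedCPP.NMinus Z ξ ω) ω) ∂P =
        (β + lam * ∫ ω, Real.exp (-γ * MarkedCPP.tauMinus Z ξ ω) ∂P) *
            (∫ ω, Real.exp (-(β + γ + lam) * ξ ω / c - κ ⬝ᵥ M 0 ω) ∂P) /
          (β + lam * ∫ ω, Real.exp (-(β + γ + lam) * ξ ω / c) ∂P)) := by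
  obtain ⟨Y, g, 𝓕, 𝓖, hd, hd', hY0, hYJ, hgZ⟩ := MarkedCPP.exists_isDriven hZ hξ hξ_indep
  have hν' : ∀ᵐ p ∂ν, 0 < p.1 := hν.mono fun _ hp => hp.1
  have := hd.isProbabilityMeasure hlam
  have hXint : Integrable (Z 1) P := by
    -- Negativity of the mean forces integrability, since otherwise the integral would be 0.
    by_contra hcon
    exact hdrift.ne (integral_undef hcon)
  have hlap : ∀ θ, 0 ≤ θ → ∫ ω, Real.exp (-θ * Z 1 ω) ∂P =
      Real.exp (MarkedCPP.cumulant c lam ν θ) := by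
    intro θ hθ
    -- The walk without the start is used here, because Z itself starts from 0.
    refine hd'.integral_exp_compoundPoisson hlam hν' hθ ?_
    filter_upwards [hYJ, hgZ, hZ.path] with ω h1 h2 h3 n hn
    have h4 := MarkedCPP.clock_eq_jumpEpoch (z := fun t => Z t ω) h2
    obtain ⟨h5, h6⟩ := hn
    rw [h4] at h5 h6
    have h7 := h3 n 1 (by exact_mod_cast h5) (by exact_mod_cast h6)
    rw [h7, MarkedCPP.jumpSum]
    simp [h1, MarkedCPP.markedJump]
  obtain ⟨δ, hδdef⟩ : ∃ δ, δ = -∫ ω, Z 1 ω ∂P := ⟨_, rfl⟩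
  have hδ : 0 < δ := by linarith
  have hψ : ∀ θ, 0 ≤ θ → δ * θ ≤ MarkedCPP.cumulant c lam ν θ := fun θ hθ =>
    hδdef ▸ MarkedCPP.neg_integral_mul_le hXint (hlap θ hθ)
  have hexp : EqOn (MarkedCPP.cumulant c lam ν) (MarkedCPP.laplaceExponent P Z) (Ici 0) := by
    intro θ hθ
    rw [MarkedCPP.laplaceExponent, hlap θ hθ, Real.log_exp]
  have hbij := (MarkedCPP.bijOn_cumulant hlam hν' hδ hψ).congr hexp
  have hdead := hd.measure_iInter_alive hlam hc hν hδ hψ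
  have hpath : ∀ᵐ ω ∂P, ∃ n, ω ∈ MarkedCPP.exitAt c Y g n ∧
      MarkedCPP.NMinus Z ξ ω = n ∧
      MarkedCPP.tauMinus Z ξ ω =
        MarkedCPP.clock g n ω + (MarkedCPP.walk c Y g n ω + (Y n ω).1) / c ∧
      MarkedCPP.lastEpoch Z ξ ω = MarkedCPP.clock g n ω ∧ M n ω = (Y n ω).2 ∧
      (∃ t, MarkedCPP.startedPath Z ξ ω t = 0) ∧
      Function.leftLim (MarkedCPP.startedPath Z ξ ω)
        (MarkedCPP.jumpEpoch (MarkedCPP.startedPath Z ξ ω) (n + 1)) ≤ 0 := by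
    filter_upwards [hY0, hYJ, hgZ, hZ.path, hd.ae_snd_pos hlam, hd.ae_fst hlam hν',
      MarkedCPP.IsDriven.ae_exists_exitAt hdead, hd.ae_walk_ne_zero hlam hc]
      with ω h1 h2 h3 h4 h5 h6 ⟨n, hn⟩ h7
    have hT : ∀ n, MarkedCPP.jumpEpoch (fun t => Z t ω) n <
        MarkedCPP.jumpEpoch (fun t => Z t ω) (n + 1) := by
      intro n
      have h8 := h5 n
      rw [h3 n, MarkedCPP.gap, sub_pos] at h8
      exact_mod_cast h8
    obtain ⟨e1, e2, e3, e4⟩ := MarkedCPP.hitZero_of_mem_exitAt (x := ξ ω) hc hT h4 h6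
      (by rw [h1]) (fun n => by rw [h2]; rfl) h3 (h7 n) hn
    refine ⟨n, hn, e1, e2, ?_, ?_, e3, e4⟩
    · have e1' : MarkedCPP.NMinus Z ξ ω = n := e1
      rw [MarkedCPP.lastEpoch, e1', MarkedCPP.clock_eq_jumpEpoch (z := fun t => Z t ω) h3]
      exact congrArg _ (MarkedCPP.jumpEpoch_const_add (ξ ω) (fun t => Z t ω) n)
    -- The mark comes from the start if no jump precedes τ_-, and from the last jump otherwise.
    · cases n with
      | zero => rw [h1]
      | succ n => rw [h2]; rfl
  refine ⟨fun θ hθ => ?_, (MarkedCPP.strictMonoOn_cumulant hlam hν' hδ hψ).congr hexp, hbij,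
    hpath.mono fun ω ⟨n, _, _, _, _, _, h1, h2⟩ => ⟨h1, n, h2⟩, fun β γ κ hβ hγ hκ => ?_⟩
  · rw [← hexp hθ, MarkedCPP.cumulant_eq hν' hθ]
  have hLHS : ∫ ω, Real.exp (-β * (MarkedCPP.tauMinus Z ξ ω - MarkedCPP.lastEpoch Z ξ ω)
      - γ * MarkedCPP.tauMinus Z ξ ω - κ ⬝ᵥ M (MarkedCPP.NMinus Z ξ ω) ω) ∂P =
      ∫ ω, MarkedCPP.exitFunctional c β γ κ Y g ω ∂P := by
    refine integral_congr_ae ?_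
    filter_upwards [hpath] with ω ⟨n, hn, e1, e2, e3, e4, _⟩
    rw [MarkedCPP.exitFunctional_eq hn, e1, e2, e3, e4]
    ring_nf
  have hτ : ∫ ω, Real.exp (-γ * MarkedCPP.tauMinus Z ξ ω) ∂P =
      ∫ ω, MarkedCPP.exitFunctional c 0 γ 0 Y g ω ∂P := by
    refine integral_congr_ae ?_
    filter_upwards [hpath] with ω ⟨n, hn, _, e2, _⟩
    rw [MarkedCPP.exitFunctional_eq hn, e2, zero_dotProduct]
    ring_nf
  have hmark : ∫ ω, Real.exp (-(β + γ + lam) * ξ ω / c - κ ⬝ᵥ M 0 ω) ∂P =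
      MarkedCPP.markTransform ν ((β + γ + lam) / c) κ := by
    rw [MarkedCPP.markTransform, ← hξ.map_eq, integral_map hξ.aemeasurable]
    · refine integral_congr_ae (ae_of_all _ fun ω => ?_)
      ring_nf
    · unfold dotProduct
      exact Measurable.aestronglyMeasurable (by fun_prop)
  have hjump : ∫ ω, Real.exp (-(β + γ + lam) * ξ ω / c) ∂P =
      MarkedCPP.jumpTransform ν ((β + γ + lam) / c) := by
    rw [MarkedCPP.jumpTransform, ← hξ.map_eq, integral_map hξ.aemeasurable
      (Measurable.aestronglyMeasurable (by fun_prop))]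
    refine integral_congr_ae (ae_of_all _ fun ω => ?_)
    ring_nf
  have hmain := hd.integral_exitFunctional (κ := κ) hlam hc hβ hγ hκ hν
  rw [← hLHS, ← hmark, ← hjump, ← hτ] at hmain
  refine ⟨?_, hmain⟩
  obtain ⟨θ, hθdef⟩ : ∃ θ, θ = MarkedCPP.invLaplaceExponent P Z γ := ⟨_, rfl⟩
  have hex : ∃ a ∈ Ici (0 : ℝ), MarkedCPP.laplaceExponent P Z a = γ := hbij.surjOn hγ
  have hθ : 0 ≤ θ := hθdef ▸ Function.invFunOn_mem hex
  have hθγ : MarkedCPP.cumulant c lam ν θ = γ := by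
    rw [hexp hθ, hθdef]
    exact Function.invFunOn_eq hex
  rw [MarkedCPP.cumulant] at hθγ
  -- Rewriting ψ(Φ(γ)) = γ gives the root condition, which also converts λ φ(Φ(γ)) into λ + γ - c
  -- Φ(γ) in the second formula.
  have hroot : lam + γ - c * θ = lam * MarkedCPP.jumpTransform ν θ := by linarith
  rw [hmain, hτ, hd.integral_exitFunctional_root hlam hc hγ hν hdead hθ hroot, ← hroot, ← hθdef,
    show β + γ - c * θ + lam = β + (lam + γ - c * θ) by ring]
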